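/- Let $d\ge 2$ and let $\eta,c_1,c_2>0$. There is a constant $C>0$ depending only on $d,\eta,c_1,c_2$ such that the following holds. Let $\Omega\subset\mathbb{R}^d$ be an open set with $|\Omega|<\infty$ and $0<\mathcal H^{d-1}(\partial\Omega)<\infty$. Let $-\Delta_\Omega$ be the Neumann Laplacian in $L^2(\Omega)$, i.e. the self-adjoint operator of the quadratic form $u\mapsto\int_\Omega|\nabla u|^2\,dx$ with form domain $H^1(\Omega)$, let $k_\Omega(t,\cdot,\cdot)$ be the (continuous) integral kernel of $e^{t\Delta_\Omega}$, $t>0$, and let $\operatorname{Tr}(e^{t\Delta_\Omega})\in[0,\infty]$ be the heat trace. Put $d_\Omega(x)=\operatorname{dist}(x,\Omega^c)$ and $$\vartheta_\Omega(s)=\frac{|\{x\in\Omega: d_\Omega(x)<s\}|}{s\,\mathcal H^{d-1}(\partial\Omega)}-1\qquad (s>0).$$ Assume that: 1. $\mathcal E_0\colon(0,\infty)\times\Omega\to\mathbb R$ is a function with $k_\Omega(t,x,x)\le t^{-d/2}\mathcal E_0(t,x)$ for all $x\in\Omega$, $t>0$. 2. $\mathcal E_1\colon(0,\infty)\times\Omega\to\mathbb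 R$ is a function with $|k_\Omega(t,x,x)-(4\pi t)^{-d/2}|\le t^{-d/2}\mathcal E_1(t,x)e^{-c_1d_\Omega(x)^2/t}$ for all $t>0$ and $x\in\Omega$ with $d_\Omega(x)\ge\eta\sqrt t$. 3. $\mathcal E_2\colon(0,\infty)^2\times\Omega\to\mathbb R$ is a function and $\mathcal G_r\subset\Omega$, $r>0$, are measurable sets with $$\Bigl|k_\Omega(t,x,x)-(4\pi t)^{-d/2}\bigl(1+e^{-d_\Omega(x)^2/t}\bigr)\Bigr|\le t^{-d/2}\mathcal E_2(r,t,x)e^{-c_2d_\Omega(x)^2/t}$$ for all $r>0$ and $(t,x)\in(0,r^2]\times\mathcal G_r$. Then, with $c=\min\{1/8,c_2/8,c_1/2\}$, for all $t>0$ and all $r\ge\max\{1,\eta\}\sqrt t$, $$\begin{aligned} \Bigl|(4\pi t)^{d/2}&\operatorname{Tr}(e^{t\Delta_\Omega})-|\Omega|-\frac{\sqrt{\pi t}}2\mathcal H^{d-1}(\partial\Omega)\Bigr|\\ \le{}& C\sqrt t\,\mathcal H^{d-1}(\partial\Omega)\Biggl(\int_0^{r/\sqrt t}s^2e^{-cs^2}|\vartheta_\Omega(s\sqrt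 t)|\,ds+e^{-cr^2/t}\\ &+\|\mathcal E_2(r,t,\cdot)\|_{L^\infty(\mathcal G_r)}\Bigl[\int_0^{2r/\sqrt t}s^2e^{-cs^2}|\vartheta_\Omega(s\sqrt t)|\,ds+1\Bigr]\\ &+\|\mathcal E_1(t,\cdot)\|_{L^\infty(\{x\in\Omega:d_\Omega(x)\ge r\})}\Bigl[\int_{r/\sqrt t}^\infty s^2e^{-cs^2}|\vartheta_\Omega(s\sqrt t)|\,ds+e^{-cr^2/t}\Bigr]\\ &+\frac1{\sqrt t\,\mathcal H^{d-1}(\partial\Omega)}\int_{\{x\in\Omega:d_\Omega(x)<r\}\setminus\mathcal G_r}(1+\mathcal E_0(t,x))\,dx\Biggr). \end{aligned}$$ The right side may be $+\infty$; if it is finite, then in particular $\operatorname{Tr}(e^{t\Delta_\Omega})<\infty$. -/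

import Mathlib

open MeasureTheory Set Filter Topology
open scoped ENNReal ContDiff InnerProductSpace

noncomputable section

namespace NeumannHeat

/-- Euclidean space `ℝ^d`. -/
abbrev Euc (d : ℕ) : Type := EuclideanSpace ℝ (Fin d)

/-- The complex Hilbert space `L²(Ω)`. -/
abbrev L2 {d : ℕ} (Ω : Set (Euc d)) : Type := Lp ℂ 2 (volume.restrict Ω)

/-- The complex Hilbert space `L²(Ω)^d` of square integrable vector fields. -/
abbrev L2Vec {d : ℕ} (Ω : Set (Euc d)) : Type :=
  Lp (EuclideanSpace ℂ (Fin d)) 2 (volume.restrict Ω)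

/-- Pairing with a test function is a bounded functional on `L²(Ω)`. -/
lemma exists_clm_integral_mul {d : ℕ} (Ω : Set (Euc d)) (ψ : Euc d → ℝ) (hψ : Continuous ψ)
    (hc : HasCompactSupport ψ) :
    ∃ L : L2 Ω →L[ℂ] ℂ, ∀ u : L2 Ω, L u = ∫ x in Ω, u x * (ψ x : ℂ) := by
  have hm : MemLp (fun x => (ψ x : ℂ)) 2 (volume.restrict Ω) :=
    ((Complex.continuous_ofReal.comp hψ).memLp_of_hasCompactSupport
      (hc.comp_left Complex.ofReal_zero)).restrict Ω
  refine ⟨innerSL ℂ (hm.toLp _), fun u => ?_⟩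
  rw [innerSL_apply_apply, L2.inner_def]
  refine integral_congr_ae ?_
  filter_upwards [hm.coeFn_toLp] with x hx
  rw [hx]
  simp

/-- `G` is the weak (distributional) gradient of `u` in the open set `Ω`. -/
def IsWeakGradient {d : ℕ} (Ω : Set (Euc d)) (u : L2 Ω) (G : L2Vec Ω) : Prop :=
  ∀ φ : Euc d → ℝ, ContDiff ℝ ∞ φ → HasCompactSupport φ → tsupport φ ⊆ Ω → ∀ i : Fin d,
    ∫ x in Ω, u x * ((fderiv ℝ φ x (EuclideanSpace.single i 1) : ℝ) : ℂ)
      = - ∫ x in Ω, G x i * (φ x : ℂ)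

/-- For each test function, the defining identity of the weak gradient says that a bounded
functional of `(u, G)` vanishes. -/
lemma exists_clm_weakGradient {d : ℕ} (Ω : Set (Euc d)) (φ : Euc d → ℝ) (h : ContDiff ℝ ∞ φ)
    (hc : HasCompactSupport φ) (i : Fin d) :
    ∃ L : WithLp 2 (L2 Ω × L2Vec Ω) →L[ℂ] ℂ, ∀ p, L p =
      (∫ x in Ω, p.fst x * ((fderiv ℝ φ x (EuclideanSpace.single i 1) : ℝ) : ℂ))
        + ∫ x in Ω, p.snd x i * (φ x : ℂ) := by
  obtain ⟨L₁, h₁⟩ := exists_clm_integral_mul Ω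
    (fun x => fderiv ℝ φ x (EuclideanSpace.single i 1))
    ((h.continuous_fderiv (by simp)).clm_apply continuous_const)
    (hc.fderiv_apply ℝ _)
  obtain ⟨L₂, h₂⟩ := exists_clm_integral_mul Ω φ h.continuous hc
  let P : L2Vec Ω →L[ℂ] L2 Ω :=
    (EuclideanSpace.proj i : EuclideanSpace ℂ (Fin d) →L[ℂ] ℂ).compLpL 2 (volume.restrict Ω)
  refine ⟨L₁.comp (WithLp.fstL 2 ℂ _ _) + (L₂.comp P).comp (WithLp.sndL 2 ℂ _ _), fun p => ?_⟩
  have e₁ := h₁ p.fst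
  have e₂ := h₂ (P p.snd)
  have e₃ : (∫ x in Ω, (P p.snd) x * (φ x : ℂ)) = ∫ x in Ω, p.snd x i * (φ x : ℂ) := by
    refine integral_congr_ae ?_
    filter_upwards [ContinuousLinearMap.coeFn_compLpL (p := 2)
      (EuclideanSpace.proj i : EuclideanSpace ℂ (Fin d) →L[ℂ] ℂ) p.snd] with x hx
    rw [hx]
    simp
  rw [e₃] at e₂
  rw [← e₁, ← e₂]
  rfl

lemma isWeakGradient_iff {d : ℕ} (Ω : Set (Euc d)) (p : WithLp 2 (L2 Ω × L2Vec Ω)) :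
    IsWeakGradient Ω p.fst p.snd ↔
      ∀ φ : Euc d → ℝ, ∀ h : ContDiff ℝ ∞ φ, ∀ hc : HasCompactSupport φ, tsupport φ ⊆ Ω →
        ∀ i : Fin d, (exists_clm_weakGradient Ω φ h hc i).choose p = 0 := by
  refine forall_congr' fun φ => forall_congr' fun h => forall_congr' fun hc =>
    forall_congr' fun _ => forall_congr' fun i => ?_
  rw [(exists_clm_weakGradient Ω φ h hc i).choose_spec p, eq_neg_iff_add_eq_zero]

/-- The Sobolev space `H¹(Ω)`, realised as the space of pairs `(u, ∇u)` with `u ∈ L²(Ω)` and weak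
gradient `∇u ∈ L²(Ω)^d`; the norm is `(‖u‖² + ‖∇u‖²)^{1/2}`. -/
def H1 {d : ℕ} (Ω : Set (Euc d)) : Submodule ℂ (WithLp 2 (L2 Ω × L2Vec Ω)) where
  carrier := {p | IsWeakGradient Ω p.fst p.snd}
  zero_mem' := by
    simp only [mem_ofPred_eq, isWeakGradient_iff, map_zero, implies_true]
  add_mem' := by
    intro p q hp hq
    simp only [mem_ofPred_eq, isWeakGradient_iff] at hp hq ⊢
    intro φ h hc hs i
    rw [map_add, hp φ h hc hs i, hq φ h hc hs i, add_zero]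
  smul_mem' := by
    intro a p hp
    simp only [mem_ofPred_eq, isWeakGradient_iff] at hp ⊢
    intro φ h hc hs i
    rw [map_smul, hp φ h hc hs i, smul_zero]

lemma isClosed_H1 {d : ℕ} (Ω : Set (Euc d)) :
    IsClosed (H1 Ω : Set (WithLp 2 (L2 Ω × L2Vec Ω))) := by
  have : (H1 Ω : Set (WithLp 2 (L2 Ω × L2Vec Ω))) = {p | IsWeakGradient Ω p.fst p.snd} := rfl
  rw [this]
  simp only [isWeakGradient_iff, ofPred_forall]
  refine isClosed_iInter fun φ => isClosed_iInter fun h => isClosed_iInter fun hc =>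
    isClosed_iInter fun _ => isClosed_iInter fun i => ?_
  exact isClosed_eq (ContinuousLinearMap.continuous _) continuous_const

instance instCompleteSpaceH1 {d : ℕ} (Ω : Set (Euc d)) : CompleteSpace (H1 Ω) :=
  (isClosed_H1 Ω).completeSpace_coe

/-- The embedding `H¹(Ω) → L²(Ω)`, `(u, ∇u) ↦ u`. -/
def H1embedding {d : ℕ} (Ω : Set (Euc d)) : H1 Ω →L[ℂ] L2 Ω :=
  (WithLp.fstL 2 ℂ (L2 Ω) (L2Vec Ω)).comp (H1 Ω).subtypeL

/-- The resolvent `(1 - Δ_Ω)⁻¹` of the Neumann Laplacian, the self-adjoint operator of the quadratic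
form `∫_Ω |∇u|²` with form domain `H¹(Ω)`. For `f ∈ L²(Ω)`, `u = (1 - Δ_Ω)⁻¹ f` is the Riesz
representative in `H¹(Ω)` of the functional `v ↦ ⟨f, v⟩`, see `neumannResolvent_spec`. -/
def neumannResolvent {d : ℕ} (Ω : Set (Euc d)) : L2 Ω →L[ℂ] L2 Ω :=
  (H1embedding Ω).comp (ContinuousLinearMap.adjoint (H1embedding Ω))

/-- `u = (1 - Δ_Ω)⁻¹ f` holds exactly when `u ∈ H¹(Ω)` is the weak solution of the Neumann problem
`u - Δu = f`: `∫ u v̄ + ∫ ∇u · ∇v̄ = ∫ f v̄` for all `v ∈ H¹(Ω)`. -/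
lemma neumannResolvent_spec {d : ℕ} (Ω : Set (Euc d)) (f u : L2 Ω) :
    neumannResolvent Ω f = u ↔ ∃ p : H1 Ω, p.1.fst = u ∧
      ∀ v : H1 Ω, ⟪v.1.fst, p.1.fst⟫_ℂ + ⟪v.1.snd, p.1.snd⟫_ℂ = ⟪v.1.fst, f⟫_ℂ := by
  have key : ∀ v p : H1 Ω, ⟪v.1.fst, p.1.fst⟫_ℂ + ⟪v.1.snd, p.1.snd⟫_ℂ = ⟪v, p⟫_ℂ := fun v p => by
    rw [Submodule.coe_inner, WithLp.prod_inner_apply]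
    rfl
  have adj : ∀ v : H1 Ω,
      ⟪v, ContinuousLinearMap.adjoint (H1embedding Ω) f⟫_ℂ = ⟪v.1.fst, f⟫_ℂ := fun v => by
    rw [ContinuousLinearMap.adjoint_inner_right]
    rfl
  constructor
  · intro h
    exact ⟨ContinuousLinearMap.adjoint (H1embedding Ω) f, h, fun v => by rw [key, adj]⟩
  · rintro ⟨p, rfl, hp⟩
    have : ContinuousLinearMap.adjoint (H1embedding Ω) f = p := by
      refine ext_inner_left ℂ fun v => ?_
      rw [adj, ← key, hp]
    change H1embedding Ω (ContinuousLinearMap.adjoint (H1embedding Ω) f) = p.1.fst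
    rw [this]
    rfl

lemma isPositive_neumannResolvent {d : ℕ} (Ω : Set (Euc d)) :
    (neumannResolvent Ω).IsPositive :=
  ContinuousLinearMap.isPositive_self_comp_adjoint _

/-- The function `ρ ↦ e^{-t(1/ρ - 1)}` on `(0, ∞)`, extended by `0`. If `ρ = (1 + λ)⁻¹`, its value
is `e^{-tλ}`. -/
def heatFun (t ρ : ℝ) : ℝ := if 0 < ρ then Real.exp (-(t * (1 / ρ - 1))) else 0

lemma heatFun_apply_inv (t : ℝ) {lam : ℝ} (h : 0 ≤ lam) :
    heatFun t (1 + lam)⁻¹ = Real.exp (-(t * lam)) := by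
  have : 0 < (1 + lam)⁻¹ := by positivity
  simp [heatFun, this]

lemma continuous_heatFun {t : ℝ} (ht : 0 < t) : Continuous (heatFun t) := by
  rw [continuous_iff_continuousAt]
  intro ρ
  rcases lt_trichotomy ρ 0 with h | rfl | h
  · have : heatFun t =ᶠ[𝓝 ρ] fun _ => 0 := by
      filter_upwards [Iio_mem_nhds h] with x hx
      simp [heatFun, not_lt.mpr (mem_Iio.mp hx).le]
    exact continuousAt_const.congr this.symm
  · have h0 : heatFun t 0 = 0 := by simp [heatFun]
    rw [ContinuousAt, h0]
    nth_rewrite 1 [← nhdsLE_sup_nhdsGT]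
    rw [tendsto_sup]
    constructor
    · refine tendsto_const_nhds.congr' ?_
      filter_upwards [self_mem_nhdsWithin] with x hx
      simp [heatFun, not_lt.mpr (mem_Iic.mp hx)]
    · have h1 : Tendsto (fun ρ : ℝ => Real.exp (-(t * (1 / ρ - 1)))) (𝓝[>] 0) (𝓝 0) := by
        refine Real.tendsto_exp_neg_atTop_nhds_zero.comp ?_
        refine Tendsto.const_mul_atTop ht ?_
        simp only [one_div]
        exact tendsto_atTop_add_const_right _ _ tendsto_inv_nhdsGT_zero
      refine h1.congr' ?_
      filter_upwards [self_mem_nhdsWithin] with x hx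
      simp [heatFun, mem_Ioi.mp hx]
  · have : heatFun t =ᶠ[𝓝 ρ] fun ρ => Real.exp (-(t * (1 / ρ - 1))) := by
      filter_upwards [Ioi_mem_nhds h] with x hx
      simp [heatFun, mem_Ioi.mp hx]
    refine ContinuousAt.congr ?_ this.symm
    have : ρ ≠ 0 := h.ne'
    fun_prop (disch := assumption)

/-- For a positive operator `R = (1 + A)⁻¹`, the operator `e^{-tA}`, by the continuous functional
calculus. -/
def expOfResolvent {H : Type*} [NormedAddCommGroup H] [InnerProductSpace ℂ H] [CompleteSpace H]
    (R : H →L[ℂ] H) (t : ℝ) : H →L[ℂ] H :=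
  cfc (heatFun t) R

/-- The Neumann heat semigroup `e^{tΔ_Ω}`, `t > 0`. -/
def heatSemigroup {d : ℕ} (Ω : Set (Euc d)) (t : ℝ) : L2 Ω →L[ℂ] L2 Ω :=
  expOfResolvent (neumannResolvent Ω) t

/-- The trace in `[0, ∞]` of a positive bounded operator, i.e. `∑ ⟨b_i, T b_i⟩` for an orthonormal
basis `b`; by `posTrace_eq` the choice of the basis is irrelevant. -/
def posTrace {H : Type*} [NormedAddCommGroup H] [InnerProductSpace ℂ H] [CompleteSpace H]
    (T : H →L[ℂ] H) : ℝ≥0∞ :=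
  ∑' i, ENNReal.ofReal
    (RCLike.re ⟪(exists_hilbertBasis ℂ H).choose_spec.choose i,
      T ((exists_hilbertBasis ℂ H).choose_spec.choose i)⟫_ℂ)

lemma ofReal_norm_sq_eq_tsum {H : Type*} [NormedAddCommGroup H] [InnerProductSpace ℂ H]
    {ι : Type*} (e : HilbertBasis ι ℂ H) (x : H) :
    ENNReal.ofReal (‖x‖ ^ 2) = ∑' i, ENNReal.ofReal (‖⟪e i, x⟫_ℂ‖ ^ 2) := by
  have h : HasSum (fun i => ‖⟪e i, x⟫_ℂ‖ ^ 2) (‖x‖ ^ 2) := by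
    have h1 := (e.hasSum_inner_mul_inner x x).mapL Complex.reCLM
    have h2 : Complex.reCLM ⟪x, x⟫_ℂ = ‖x‖ ^ 2 := by
      rw [inner_self_eq_norm_sq_to_K]
      simp [← Complex.ofReal_pow]
    rw [h2] at h1
    refine h1.congr_fun ?_
    intro i
    rw [← inner_conj_symm x (e i), mul_comm, RCLike.mul_conj]
    simp [← Complex.ofReal_pow]
  rw [← h.tsum_eq, ENNReal.ofReal_tsum_of_nonneg (fun i => by positivity) h.summable]

lemma tsum_norm_sq_adjoint {H : Type*} [NormedAddCommGroup H] [InnerProductSpace ℂ H]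
    [CompleteSpace H] (S : H →L[ℂ] H) {ι κ : Type*} (b : HilbertBasis ι ℂ H)
    (c : HilbertBasis κ ℂ H) :
    ∑' i, ENNReal.ofReal (‖S (b i)‖ ^ 2)
      = ∑' j, ENNReal.ofReal (‖ContinuousLinearMap.adjoint S (c j)‖ ^ 2) := by
  have h1 : ∀ i, ENNReal.ofReal (‖S (b i)‖ ^ 2)
      = ∑' j, ENNReal.ofReal (‖⟪c j, S (b i)⟫_ℂ‖ ^ 2) := fun i => ofReal_norm_sq_eq_tsum c _
  have h2 : ∀ j, ENNReal.ofReal (‖ContinuousLinearMap.adjoint S (c j)‖ ^ 2)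
      = ∑' i, ENNReal.ofReal (‖⟪c j, S (b i)⟫_ℂ‖ ^ 2) := fun j => by
    rw [ofReal_norm_sq_eq_tsum b]
    refine tsum_congr fun i => ?_
    rw [ContinuousLinearMap.adjoint_inner_right, norm_inner_symm]
  simp_rw [h1, h2]
  exact ENNReal.tsum_comm

lemma posTrace_eq {H : Type*} [NormedAddCommGroup H] [InnerProductSpace ℂ H]
    [CompleteSpace H] {T : H →L[ℂ] H} (hT : T.IsPositive) {ι : Type*} (b : HilbertBasis ι ℂ H) :
    posTrace T = ∑' i, ENNReal.ofReal (RCLike.re ⟪b i, T (b i)⟫_ℂ) := by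
  obtain ⟨S, rfl⟩ := CStarAlgebra.nonneg_iff_eq_star_mul_self.mp
    ((ContinuousLinearMap.nonneg_iff_isPositive T).mpr hT)
  have h : ∀ x : H, RCLike.re ⟪x, (star S * S) x⟫_ℂ = ‖S x‖ ^ 2 := fun x => by
    rw [ContinuousLinearMap.star_eq_adjoint, mul_apply_eq_comp,
      ContinuousLinearMap.adjoint_inner_right, inner_self_eq_norm_sq]
  unfold posTrace
  simp_rw [h]
  rw [tsum_norm_sq_adjoint S _ b, ← tsum_norm_sq_adjoint S b b]

/-- The heat trace `Tr e^{tΔ_Ω} ∈ [0, ∞]`. -/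
def heatTrace {d : ℕ} (Ω : Set (Euc d)) (t : ℝ) : ℝ≥0∞ := posTrace (heatSemigroup Ω t)

/-- The normalised indicator function `|B_ε(x)|⁻¹ 1_{B_ε(x)}`, as an element of `L²(Ω)`. -/
def ballAverage {d : ℕ} (Ω : Set (Euc d)) (x : Euc d) (ε : ℝ) : L2 Ω :=
  indicatorConstLp 2 (measurableSet_closedBall (x := x) (ε := ε))
    ((Measure.restrict_apply_le Ω _).trans_lt measure_closedBall_lt_top).ne
    (((volume.real (Metric.closedBall x ε))⁻¹ : ℝ) : ℂ)

/-- The Neumann heat kernel `k_Ω(t, x, y)`, the integral kernel of `e^{tΔ_Ω}`, with its pointwise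
values for `x, y ∈ Ω` obtained as the limit of the means of the kernel over `B_ε(x) × B_ε(y)`:
`k_Ω(t, x, y) = lim_{ε → 0} ⟨|B_ε(x)|⁻¹ 1_{B_ε(x)}, e^{tΔ_Ω} |B_ε(y)|⁻¹ 1_{B_ε(y)}⟩`.
By `heatKernel_eq`, this is the continuous integral kernel of `e^{tΔ_Ω}`. Writing a lower limit
with values in `[-∞, ∞]` makes the definition independent of any regularity theory. -/
def heatKernel {d : ℕ} (Ω : Set (Euc d)) (t : ℝ) (x y : Euc d) : EReal :=
  liminf (fun ε : ℝ => ((RCLike.re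
    ⟪ballAverage Ω x ε, heatSemigroup Ω t (ballAverage Ω y ε)⟫_ℂ : ℝ) : EReal)) (𝓝[>] 0)

/-- If the values of `g` on a ball are `δ`-close to `c`, so is its mean over the ball. -/
lemma norm_mean_sub_le {d : ℕ} {x : Euc d} {ε δ : ℝ} (hε : 0 < ε) {g : Euc d → ℂ} {c : ℂ}
    (hg : IntegrableOn g (Metric.closedBall x ε))
    (h : ∀ᵐ z ∂(volume.restrict (Metric.closedBall x ε)), ‖g z - c‖ ≤ δ) :
    ‖((volume.real (Metric.closedBall x ε))⁻¹ : ℝ) * (∫ z in Metric.closedBall x ε, g z) - c‖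
      ≤ δ := by
  set B := Metric.closedBall x ε
  have hB : volume B < ⊤ := measure_closedBall_lt_top
  have hpos : 0 < volume.real B :=
    ENNReal.toReal_pos (Metric.measure_closedBall_pos _ _ hε).ne' hB.ne
  have h1 := norm_setIntegral_le_of_norm_le_const_ae hB h
  rw [integral_sub hg (integrableOn_const hB.ne), setIntegral_const] at h1
  have h2 : ((volume.real B)⁻¹ : ℝ) * (∫ z in B, g z) - c
      = ((volume.real B)⁻¹ : ℝ) * ((∫ z in B, g z) - volume.real B • c) := by
    have : (volume.real B : ℂ) ≠ 0 := by exact_mod_cast hpos.ne'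
    rw [Complex.real_smul]
    push_cast
    field_simp
  rw [h2, norm_mul, Complex.norm_real, Real.norm_of_nonneg (by positivity)]
  calc _ ≤ (volume.real B)⁻¹ * (δ * volume.real B) := by gcongr
    _ = δ := by field_simp

/-- If `κ` is a continuous integral kernel of `e^{tΔ_Ω}`, then `k_Ω(t, ·, ·) = κ` on `Ω × Ω`. -/
theorem heatKernel_eq {d : ℕ} {Ω : Set (Euc d)} (hΩ : IsOpen Ω) {t : ℝ} {κ : Euc d → Euc d → ℝ}
    (hκ : ContinuousOn (fun p : Euc d × Euc d => κ p.1 p.2) (Ω ×ˢ Ω))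
    (hker : ∀ f : L2 Ω, ∀ᵐ x ∂(volume.restrict Ω),
      heatSemigroup Ω t f x = ∫ y in Ω, (κ x y : ℂ) * f y)
    {x y : Euc d} (hx : x ∈ Ω) (hy : y ∈ Ω) :
    heatKernel Ω t x y = (κ x y : EReal) := by
  have key : Tendsto (fun ε : ℝ => RCLike.re
      ⟪ballAverage Ω x ε, heatSemigroup Ω t (ballAverage Ω y ε)⟫_ℂ) (𝓝[>] 0) (𝓝 (κ x y)) := by
    rw [Metric.tendsto_nhds]
    intro δ hδ
    have hcont : ContinuousAt (fun p : Euc d × Euc d => κ p.1 p.2) (x, y) :=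
      hκ.continuousAt ((hΩ.prod hΩ).mem_nhds ⟨hx, hy⟩)
    have hev := (Metric.tendsto_nhds.mp hcont (δ / 2) (half_pos hδ)).and
      ((hΩ.prod hΩ).mem_nhds (⟨hx, hy⟩ : (x, y) ∈ Ω ×ˢ Ω))
    obtain ⟨ρ, hρ, hball⟩ := Metric.eventually_nhds_iff.mp hev
    filter_upwards [Ioo_mem_nhdsGT hρ] with ε hε
    have hin : ∀ z ∈ Metric.closedBall x ε, ∀ w ∈ Metric.closedBall y ε,
        dist (κ z w) (κ x y) < δ / 2 ∧ (z, w) ∈ Ω ×ˢ Ω := fun z hz w hw =>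
      hball (y := (z, w)) (by
        rw [Prod.dist_eq]
        exact max_lt (lt_of_le_of_lt hz hε.2) (lt_of_le_of_lt hw hε.2))
    have hsx : Metric.closedBall x ε ⊆ Ω := fun z hz =>
      (hin z hz y (Metric.mem_closedBall_self hε.1.le)).2.1
    have hsy : Metric.closedBall y ε ⊆ Ω := fun w hw =>
      (hin x (Metric.mem_closedBall_self hε.1.le) w hw).2.2
    set g : L2 Ω := heatSemigroup Ω t (ballAverage Ω y ε) with hgdef
    have hmem : MemLp (g : Euc d → ℂ) 2 (volume.restrict (Metric.closedBall x ε)) :=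
      (Lp.memLp g).mono_measure (Measure.restrict_mono hsx le_rfl)
    have hgint : IntegrableOn (g : Euc d → ℂ) (Metric.closedBall x ε) := by
      have : IsFiniteMeasure (volume.restrict (Metric.closedBall x ε)) :=
        ⟨by simpa using measure_closedBall_lt_top⟩
      exact hmem.integrable (by norm_num)
    have hgclose : ∀ᵐ z ∂(volume.restrict (Metric.closedBall x ε)),
        ‖g z - (κ x y : ℂ)‖ ≤ δ / 2 := by
      filter_upwards [ae_mono (Measure.restrict_mono hsx le_rfl) (hker (ballAverage Ω y ε)),
        ae_restrict_mem measurableSet_closedBall] with z hz hzB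
      have e1 : (∫ w in Ω, (κ z w : ℂ) * ballAverage Ω y ε w)
          = ((volume.real (Metric.closedBall y ε))⁻¹ : ℝ)
            * ∫ w in Metric.closedBall y ε, (κ z w : ℂ) := by
        have : (∫ w in Ω, (κ z w : ℂ) * ballAverage Ω y ε w) = ∫ w in Ω,
            (Metric.closedBall y ε).indicator (fun w =>
              (((volume.real (Metric.closedBall y ε))⁻¹ : ℝ) : ℂ) * (κ z w : ℂ)) w := by
          refine integral_congr_ae ?_
          filter_upwards [indicatorConstLp_coeFn (p := 2) (μ := volume.restrict Ω)
            (hs := measurableSet_closedBall (x := y) (ε := ε))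
            (hμs := ((Measure.restrict_apply_le Ω _).trans_lt measure_closedBall_lt_top).ne)
            (c := (((volume.real (Metric.closedBall y ε))⁻¹ : ℝ) : ℂ))] with w hw
          rw [ballAverage, hw]
          by_cases hwB : w ∈ Metric.closedBall y ε <;> simp [hwB, mul_comm]
        rw [this, setIntegral_indicator measurableSet_closedBall, inter_eq_self_of_subset_right hsy,
          integral_const_mul]
      rw [hgdef, hz, e1]
      refine norm_mean_sub_le hε.1 ?_ ?_
      · refine ContinuousOn.integrableOn_compact (isCompact_closedBall _ _) ?_
        refine Complex.continuous_ofReal.comp_continuousOn ?_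
        refine hκ.comp (f := fun w => (z, w)) (by fun_prop) fun w hw => (hin z hzB w hw).2
      · filter_upwards [ae_restrict_mem measurableSet_closedBall] with w hw
        rw [← Complex.ofReal_sub, Complex.norm_real]
        exact (hin z hzB w hw).1.le
    have hmean := norm_mean_sub_le hε.1 hgint hgclose
    have e2 : ⟪ballAverage Ω x ε, g⟫_ℂ = ((volume.real (Metric.closedBall x ε))⁻¹ : ℝ)
        * ∫ z in Metric.closedBall x ε, g z := by
      rw [ballAverage, L2.inner_indicatorConstLp_eq_inner_setIntegral,
        Measure.restrict_restrict measurableSet_closedBall, inter_eq_self_of_subset_left hsx]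
      simp [mul_comm]
    rw [e2, Real.dist_eq]
    refine lt_of_le_of_lt (le_trans ?_ hmean) (half_lt_self hδ)
    refine le_trans (le_of_eq ?_) (Complex.abs_re_le_norm _)
    rw [Complex.sub_re, Complex.ofReal_re]
    rfl
  exact ((continuous_coe_real_ereal.tendsto _).comp key).liminf_eq

/-- `d_Ω(x) = dist(x, Ω^c)`. -/
def bdryDist {d : ℕ} (Ω : Set (Euc d)) (x : Euc d) : ℝ := Metric.infDist x Ωᶜ

/-- `H^{d-1}(∂Ω)`, where the Hausdorff measure has its usual normalisation
(`μHE[n]` is Lebesgue measure on `ℝ^n`). -/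
def perim {d : ℕ} (Ω : Set (Euc d)) : ℝ≥0∞ := μHE[d - 1] (frontier Ω)

/-- `ϑ_Ω(s) = |{x ∈ Ω : d_Ω(x) < s}| / (s H^{d-1}(∂Ω)) - 1`. -/
def vartheta {d : ℕ} (Ω : Set (Euc d)) (s : ℝ) : ℝ :=
  volume.real {x ∈ Ω | bdryDist Ω x < s} / (s * (perim Ω).toReal) - 1

/-- The weighted integral `∫_I s² e^{-c s²} |ϑ_Ω(s √t)| ds`. -/
def varthetaIntegral {d : ℕ} (Ω : Set (Euc d)) (c t : ℝ) (I : Set ℝ) : ℝ≥0∞ :=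
  ∫⁻ s in I, ENNReal.ofReal (s ^ 2 * Real.exp (-(c * s ^ 2)) * |vartheta Ω (s * √t)|)

end NeumannHeat

end

namespace NeumannHeat

/-! The trace is the integral of the diagonal kernel, and `(4πt)^{d/2} k(t,x,x)` is compared with
the model `w = 1 + 1_{d_Ω < r} e^{-d_Ω²/t}`. The assumed kernel bounds control the difference far
from the boundary, on the good set, and crudely on the remaining collar (`lintegral_regions_le`). It
remains to integrate Gaussians of `δ = d_Ω/√t`.

With `ρ = r/√t`, `L = √t H^{d-1}(∂Ω)` and `q(u) = ϑ_Ω(u√t)`, the collar `{δ < u}` has volume `L u (1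
+ q(u))`. The layer cake formula integrates this against `2a u e^{-a u²}`. For `a = 1` the part
without `q` gives `2L ∫_0^∞ u² e^{-u²} du = √(πt)/2 H^{d-1}(∂Ω)` up to a Gaussian tail, and the rest
is bounded by weighted integrals of `|q|`.

The cut-off at `ρ` leaves the boundary term `e^{-aρ²} |{δ < ρ}|`, which involves `q` at a single
point and not in the mean. A doubling property removes it: moving each point half way to a nearest
point of `Ω^c` is injective with 2-Lipschitz inverse, so halving the collar width costs at most
`2^d` in volume (`volume_collar_le`). The value at `ρ` is then bounded by values at nearby smaller
`u`, and averaging over `u` gives `exp_mul_measure_le`.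

No regularity of the heat kernel enters. Writing `e^{tΔ} = S*S` gives the diagonal density `∑ |S*
b_i|²`, which Lebesgue differentiation compares with the limit of ball means defining the kernel
(`exists_diagonal_density`). One inequality holds always and bounds the trace from above, whence its
finiteness; the other is needed only if the trace is finite. -/

/-! ### Gaussian integrals on the half-line -/

lemma lintegral_Ioi_gaussian_deriv {a x : ℝ} (ha : 0 < a) (hx : 0 ≤ x) :
    ∫⁻ u in Ioi x, ENNReal.ofReal (2 * a * u * Real.exp (-(a * u ^ 2)))
      = ENNReal.ofReal (Real.exp (-(a * x ^ 2))) := by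
  have hd : ∀ u ∈ Ici x, HasDerivAt (fun u => -Real.exp (-(a * u ^ 2)))
      (2 * a * u * Real.exp (-(a * u ^ 2))) u := fun u _ => by
    have h := ((((hasDerivAt_pow 2 u).const_mul a).neg).exp).neg
    refine h.congr_deriv ?_
    norm_num
    ring
  have hpos : ∀ u ∈ Ioi x, 0 ≤ 2 * a * u * Real.exp (-(a * u ^ 2)) := fun u hu => by
    have : 0 ≤ u := hx.trans (le_of_lt hu)
    positivity
  have hlim : Tendsto (fun u : ℝ => -Real.exp (-(a * u ^ 2))) atTop (𝓝 0) := by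
    rw [← neg_zero]
    refine (Real.tendsto_exp_neg_atTop_nhds_zero.comp ?_).neg
    exact (tendsto_pow_atTop (by norm_num)).const_mul_atTop ha
  have hint := integrableOn_Ioi_deriv_of_nonneg' hd hpos hlim
  rw [← ofReal_integral_eq_lintegral_ofReal hint
    ((ae_restrict_iff' measurableSet_Ioi).mpr (ae_of_all _ hpos)),
    integral_Ioi_of_hasDerivAt_of_nonneg' hd hpos hlim]
  simp

/-- The second moment `∫_0^∞ u² e^{-b u²} du`. -/
noncomputable def gaussMoment (b : ℝ) : ℝ≥0∞ :=
  ∫⁻ u in Ioi (0 : ℝ), ENNReal.ofReal (u ^ 2 * Real.exp (-(b * u ^ 2)))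

lemma gaussMoment_ne_top {b : ℝ} (hb : 0 < b) : gaussMoment b ≠ ⊤ := by
  have h := (integrableOn_rpow_mul_exp_neg_mul_sq hb (s := 2) (by norm_num)).lintegral_lt_top
  refine ne_of_lt (lt_of_le_of_lt (le_of_eq ?_) h)
  unfold gaussMoment
  refine lintegral_congr fun u => ?_
  rw [Real.rpow_two, neg_mul]

lemma gaussMoment_one : gaussMoment 1 = ENNReal.ofReal (√Real.pi / 4) := by
  have hint := integrableOn_rpow_mul_exp_neg_mul_sq one_pos (s := 2) (by norm_num)
  have h2 := integral_rpow_mul_exp_neg_rpow (p := 2) (q := 2) (by norm_num) (by norm_num)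
  have h3 : Real.Gamma ((2 + 1) / 2) = √Real.pi / 2 := by
    rw [show ((2 : ℝ) + 1) / 2 = 1 / 2 + 1 by norm_num, Real.Gamma_add_one (by norm_num),
      Real.Gamma_one_half_eq]
    ring
  rw [h3] at h2
  unfold gaussMoment
  have h4 : ∫ u in Ioi (0 : ℝ), u ^ (2 : ℝ) * Real.exp (-1 * u ^ 2) = √Real.pi / 4 := by
    rw [show √Real.pi / 4 = 1 / 2 * (√Real.pi / 2) by ring, ← h2]
    refine integral_congr_ae (ae_of_all _ fun u => ?_)
    simp
  rw [← h4, ofReal_integral_eq_lintegral_ofReal hint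
    (ae_of_all _ fun u => mul_nonneg (by rw [Real.rpow_two]; positivity) (Real.exp_pos _).le)]
  refine lintegral_congr fun u => ?_
  rw [Real.rpow_two, neg_mul]

/-- Since `a ≥ 2c`, one factor `e^{-cu²} ≤ e^{-cρ²}` can be split off on `u > ρ`, and the other
keeps the second moment finite. -/
lemma lintegral_sq_gaussian_tail_le {a c ρ : ℝ} (hc : 0 < c) (hca : 2 * c ≤ a) (hρ : 0 ≤ ρ) :
    ∫⁻ u in Ioi ρ, ENNReal.ofReal (u ^ 2 * Real.exp (-(a * u ^ 2)))
      ≤ ENNReal.ofReal (Real.exp (-(c * ρ ^ 2))) * gaussMoment c := by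
  unfold gaussMoment
  rw [← lintegral_const_mul' _ _ ENNReal.ofReal_ne_top]
  refine (lintegral_mono_set (Ioi_subset_Ioi hρ) |>.trans' ?_)
  refine setLIntegral_mono' measurableSet_Ioi fun u hu => ?_
  rw [← ENNReal.ofReal_mul (Real.exp_pos _).le]
  refine ENNReal.ofReal_le_ofReal ?_
  rw [mul_left_comm, ← Real.exp_add]
  have : ρ ^ 2 ≤ u ^ 2 := pow_le_pow_left₀ hρ (le_of_lt hu) 2
  gcongr
  nlinarith [sq_nonneg u]

/-! ### Layer cake estimates for Gaussians of a distance function -/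

section LayerCake

variable {α : Type*} [MeasurableSpace α] {μ : Measure α} {δ : α → ℝ}

/-- Layer cake formula for a Gaussian of a nonnegative function. -/
lemma lintegral_gaussian_eq [SFinite μ] (hδ : Measurable δ) (hδ0 : ∀ x, 0 ≤ δ x) {a : ℝ} (ha : 0 < a)
    {A : Set α} :
    ∫⁻ x in A, ENNReal.ofReal (Real.exp (-(a * δ x ^ 2))) ∂μ
      = ∫⁻ u in Ioi 0, ENNReal.ofReal (2 * a * u * Real.exp (-(a * u ^ 2)))
          * μ ({x | δ x < u} ∩ A) := by
  have h1 : ∀ x, ENNReal.ofReal (Real.exp (-(a * δ x ^ 2))) = ∫⁻ u in Ioi 0,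
      {p : α × ℝ | δ p.1 < p.2}.indicator
        (fun p => ENNReal.ofReal (2 * a * p.2 * Real.exp (-(a * p.2 ^ 2)))) (x, u) := fun x => by
    rw [← lintegral_Ioi_gaussian_deriv ha (hδ0 x), ← lintegral_indicator measurableSet_Ioi,
      ← lintegral_indicator measurableSet_Ioi]
    refine lintegral_congr fun u => ?_
    by_cases hu : δ x < u
    · have : 0 < u := (hδ0 x).trans_lt hu
      simp [indicator, hu, this]
    · simp [indicator, hu]
  simp_rw [h1]
  rw [lintegral_lintegral_swap]
  · refine lintegral_congr fun u => ?_
    have : ∀ x, {p : α × ℝ | δ p.1 < p.2}.indicator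
        (fun p => ENNReal.ofReal (2 * a * p.2 * Real.exp (-(a * p.2 ^ 2)))) (x, u)
        = {x | δ x < u}.indicator
          (fun _ => ENNReal.ofReal (2 * a * u * Real.exp (-(a * u ^ 2)))) x := fun x => rfl
    simp_rw [this]
    have hm : MeasurableSet {x | δ x < u} := measurableSet_lt hδ measurable_const
    rw [lintegral_indicator_const hm, Measure.restrict_apply hm]
  · refine Measurable.aemeasurable ?_
    refine Measurable.indicator (by fun_prop) ?_
    exact measurableSet_lt (by fun_prop) (by fun_prop)

/-- For `u ≥ ρ` the set `{δ < u} ∩ {δ < ρ}` no longer grows, so the tail of the weight integrates to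
the boundary term at `ρ`. -/
lemma lintegral_gaussian_sublevel [SFinite μ] (hδ : Measurable δ) (hδ0 : ∀ x, 0 ≤ δ x) {a ρ : ℝ} (ha : 0 < a)
    (hρ : 0 < ρ) :
    ∫⁻ x in {x | δ x < ρ}, ENNReal.ofReal (Real.exp (-(a * δ x ^ 2))) ∂μ
      = (∫⁻ u in Ioo 0 ρ, ENNReal.ofReal (2 * a * u * Real.exp (-(a * u ^ 2))) * μ {x | δ x < u})
        + ENNReal.ofReal (Real.exp (-(a * ρ ^ 2))) * μ {x | δ x < ρ} := by
  rw [lintegral_gaussian_eq hδ hδ0 ha, ← Ioo_union_Ici_eq_Ioi hρ,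
    lintegral_union measurableSet_Ici
      (disjoint_left.mpr fun u hu hu' => (not_le.mpr hu.2) hu')]
  congr 1
  · refine setLIntegral_congr_fun measurableSet_Ioo fun u hu => ?_
    have : {x | δ x < u} ∩ {x | δ x < ρ} = {x | δ x < u} :=
      inter_eq_self_of_subset_left fun x (hx : δ x < u) => hx.trans hu.2
    rw [this]
  · rw [← lintegral_Ioi_gaussian_deriv ha hρ.le, ← lintegral_mul_const _ (by fun_prop),
      setLIntegral_congr Ioi_ae_eq_Ici.symm]
    refine setLIntegral_congr_fun measurableSet_Ioi fun u hu => ?_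
    have : {x | δ x < u} ∩ {x | δ x < ρ} = {x | δ x < ρ} :=
      inter_eq_self_of_subset_right fun x (hx : δ x < ρ) => hx.trans hu
    rw [this]

lemma lintegral_gaussian_superlevel_le [SFinite μ] (hδ : Measurable δ) (hδ0 : ∀ x, 0 ≤ δ x) {a ρ : ℝ}
    (ha : 0 < a) (hρ : 0 < ρ) :
    ∫⁻ x in {x | ρ ≤ δ x}, ENNReal.ofReal (Real.exp (-(a * δ x ^ 2))) ∂μ
      ≤ ∫⁻ u in Ioi ρ, ENNReal.ofReal (2 * a * u * Real.exp (-(a * u ^ 2)))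
          * μ {x | δ x < u} := by
  rw [lintegral_gaussian_eq hδ hδ0 ha, ← Ioc_union_Ioi_eq_Ioi hρ.le,
    lintegral_union measurableSet_Ioi
      (disjoint_left.mpr fun u hu hu' => (not_lt.mpr hu.2) hu')]
  have h0 : ∫⁻ u in Ioc 0 ρ, ENNReal.ofReal (2 * a * u * Real.exp (-(a * u ^ 2)))
      * μ ({x | δ x < u} ∩ {x | ρ ≤ δ x}) = 0 := by
    rw [← lintegral_zero (μ := volume.restrict (Ioc 0 ρ))]
    refine setLIntegral_congr_fun measurableSet_Ioc fun u hu => ?_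
    have : {x | δ x < u} ∩ {x | ρ ≤ δ x} = ∅ :=
      eq_empty_of_forall_notMem fun x hx => (not_le.mpr (hx.1.trans_le hu.2)) hx.2
    rw [this, measure_empty, mul_zero]
  rw [h0, zero_add]
  gcongr
  exact inter_subset_left

/-- The weighted integral `∫_I u² e^{-c u²} |q(u)| du`. -/
noncomputable def gaussIntegral (q : ℝ → ℝ) (c : ℝ) (I : Set ℝ) : ℝ≥0∞ :=
  ∫⁻ u in I, ENNReal.ofReal (u ^ 2 * Real.exp (-(c * u ^ 2)) * |q u|)

variable {q : ℝ → ℝ} {L : ℝ≥0∞}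

/-- Only the part with `|q|` is relaxed to the exponent `c`; the other part keeps `a`, because for
`a = 1` it must yield the sharp main term. -/
lemma lintegral_weight_mul_measure_le (hL : L ≠ ⊤)
    (hV : ∀ u, 0 < u → μ {x | δ x < u} ≤ L * ENNReal.ofReal (u * (1 + |q u|)))
    {a c : ℝ} (ha : 0 < a) (hca : c ≤ a) {I : Set ℝ} (hI : MeasurableSet I) (hI0 : I ⊆ Ioi 0) :
    ∫⁻ u in I, ENNReal.ofReal (2 * a * u * Real.exp (-(a * u ^ 2))) * μ {x | δ x < u}
      ≤ ENNReal.ofReal (2 * a) * L *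
        ((∫⁻ u in I, ENNReal.ofReal (u ^ 2 * Real.exp (-(a * u ^ 2)))) + gaussIntegral q c I) := by
  unfold gaussIntegral
  rw [← lintegral_add_left (by fun_prop),
    ← lintegral_const_mul' _ _ (ENNReal.mul_ne_top ENNReal.ofReal_ne_top hL)]
  refine setLIntegral_mono' hI fun u hu => ?_
  have hu0 : 0 < u := hI0 hu
  have hexp : Real.exp (-(a * u ^ 2)) ≤ Real.exp (-(c * u ^ 2)) := by gcongr
  calc _ ≤ ENNReal.ofReal (2 * a * u * Real.exp (-(a * u ^ 2)))
          * (L * ENNReal.ofReal (u * (1 + |q u|))) := by gcongr; exact hV u hu0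
    _ = L * ENNReal.ofReal (2 * a * u * Real.exp (-(a * u ^ 2)) * (u * (1 + |q u|))) := by
        rw [ENNReal.ofReal_mul (p := 2 * a * u * _) (by positivity)]
        ring
    _ ≤ L * ENNReal.ofReal (2 * a * (u ^ 2 * Real.exp (-(a * u ^ 2))
          + u ^ 2 * Real.exp (-(c * u ^ 2)) * |q u|)) := by
        refine mul_le_mul' le_rfl (ENNReal.ofReal_le_ofReal ?_)
        have : u ^ 2 * Real.exp (-(a * u ^ 2)) * |q u|
          ≤ u ^ 2 * Real.exp (-(c * u ^ 2)) * |q u| := by gcongr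
        calc _ = 2 * a * (u ^ 2 * Real.exp (-(a * u ^ 2))
              + u ^ 2 * Real.exp (-(a * u ^ 2)) * |q u|) := by ring
          _ ≤ _ := by gcongr
    _ = _ := by
        rw [ENNReal.ofReal_mul (by positivity), ENNReal.ofReal_add (by positivity) (by positivity)]
        ring

lemma lintegral_gaussian_superlevel_le_gaussIntegral [SFinite μ] (hδ : Measurable δ) (hδ0 : ∀ x, 0 ≤ δ x)
    (hL : L ≠ ⊤) (hV : ∀ u, 0 < u → μ {x | δ x < u} ≤ L * ENNReal.ofReal (u * (1 + |q u|)))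
    {a c ρ : ℝ} (hc : 0 < c) (hca : 2 * c ≤ a) (hρ : 0 < ρ) :
    ∫⁻ x in {x | ρ ≤ δ x}, ENNReal.ofReal (Real.exp (-(a * δ x ^ 2))) ∂μ
      ≤ ENNReal.ofReal (2 * a) * (gaussMoment c + 1) *
        (L * (gaussIntegral q c (Ioi ρ) + ENNReal.ofReal (Real.exp (-(c * ρ ^ 2))))) := by
  refine (lintegral_gaussian_superlevel_le hδ hδ0 (by linarith) hρ).trans
    ((lintegral_weight_mul_measure_le hL hV (by linarith) (by linarith : c ≤ a) measurableSet_Ioi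
      (Ioi_subset_Ioi hρ.le)).trans ?_)
  calc _ ≤ ENNReal.ofReal (2 * a) * L *
          (ENNReal.ofReal (Real.exp (-(c * ρ ^ 2))) * gaussMoment c + gaussIntegral q c (Ioi ρ)) := by
        gcongr
        exact lintegral_sq_gaussian_tail_le hc hca hρ.le
    -- Cross terms are added so that the sum factors.
    _ ≤ ENNReal.ofReal (2 * a) * L *
          (ENNReal.ofReal (Real.exp (-(c * ρ ^ 2))) * gaussMoment c + gaussIntegral q c (Ioi ρ))
        + ENNReal.ofReal (2 * a) * L * (gaussIntegral q c (Ioi ρ) * gaussMoment c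
          + ENNReal.ofReal (Real.exp (-(c * ρ ^ 2)))) := le_self_add
    _ = _ := by ring

/-- Under a doubling condition on `u ↦ μ {δ < u}`, its values are controlled by its means. -/
lemma exp_mul_measure_le (hL : L ≠ ⊤)
    (hV : ∀ u, 0 < u → μ {x | δ x < u} ≤ L * ENNReal.ofReal (u * (1 + |q u|)))
    {K : ℝ≥0∞} (hK : K ≠ ⊤) {a c ρ : ℝ} (hc : 0 < c) (hca : 2 * c ≤ a) (hρ : 1 ≤ ρ)
    (hdouble : μ {x | δ x < ρ} ≤ K * μ {x | δ x < ρ / 2}) :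
    ENNReal.ofReal (Real.exp (-(a * ρ ^ 2))) * μ {x | δ x < ρ}
      ≤ 2 * K * ENNReal.ofReal (1 / c + 2) *
        (L * (gaussIntegral q c (Ioo 0 ρ) + ENNReal.ofReal (Real.exp (-(c * ρ ^ 2))))) := by
  set X := ENNReal.ofReal (Real.exp (-(a * ρ ^ 2))) * μ {x | δ x < ρ}
  set E := Real.exp (-(c * ρ ^ 2)) with hE
  -- As `ρ ≥ 1`, such `u` exceed `ρ/2`, so doubling bounds the value at `ρ` by the value at `u`.
  -- Integrating over this interval of length `1/2` turns `q(u)` into a mean.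
  have hpt : ∀ u ∈ Ioo (ρ - 1 / 2) ρ, X ≤ K * L * ENNReal.ofReal (1 / c + 2) *
      (ENNReal.ofReal E + ENNReal.ofReal (u ^ 2 * Real.exp (-(c * u ^ 2)) * |q u|)) := by
    intro u hu
    have hu1 : ρ / 2 < u := by linarith [hu.1]
    have hu2 : 1 / 2 < u := by linarith [hu.1]
    have hle : Real.exp (-(a * ρ ^ 2)) * (u * (1 + |q u|))
        ≤ (1 / c + 2) * (E + u ^ 2 * Real.exp (-(c * u ^ 2)) * |q u|) := by
      -- The condition `a ≥ 2c` supplies two factors `E`. Without `q`, one of them absorbs `u ≤ ρ²`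
      -- through `x e^{-x} ≤ 1`. With `|q|`, one becomes `e^{-cu²}`, the other is dropped, and `u ≤
      -- 2u²` since `u > 1/2`.
      have e1 : Real.exp (-(a * ρ ^ 2)) ≤ E * E := by
        rw [hE, ← Real.exp_add]
        gcongr
        nlinarith [sq_nonneg ρ]
      have e2 : c * ρ ^ 2 * E ≤ 1 := by
        rw [hE, Real.exp_neg]
        have h := Real.add_one_le_exp (c * ρ ^ 2)
        have hp := Real.exp_pos (c * ρ ^ 2)
        rw [← div_eq_mul_inv, div_le_one hp]
        linarith
      have e3 : E * u ≤ 1 / c := by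
        rw [le_div_iff₀ hc]
        have h3 : u ≤ ρ ^ 2 := by nlinarith [hu.2]
        have : E * u * c ≤ E * ρ ^ 2 * c := by gcongr
        nlinarith
      have e4 : E ≤ Real.exp (-(c * u ^ 2)) := by
        have : u ^ 2 ≤ ρ ^ 2 := pow_le_pow_left₀ (by linarith) hu.2.le 2
        rw [hE]
        gcongr
      have e5 : E ≤ 1 := by
        rw [hE, Real.exp_le_one_iff]
        have : 0 ≤ c * ρ ^ 2 := by positivity
        linarith
      have e6 : 0 < E := Real.exp_pos _
      have f1 : E * E * u ≤ 1 / c * E := by nlinarith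
      have f2 : E * E * u ≤ 2 * (u ^ 2 * Real.exp (-(c * u ^ 2))) := by
        calc E * E * u ≤ 1 * Real.exp (-(c * u ^ 2)) * u := by gcongr
          _ = Real.exp (-(c * u ^ 2)) * u := by ring
          _ ≤ Real.exp (-(c * u ^ 2)) * (2 * u ^ 2) := by
            gcongr
            nlinarith
          _ = _ := by ring
      have f3 : 0 ≤ 1 / c := by positivity
      have hq := abs_nonneg (q u)
      have hu' : 0 ≤ u * (1 + |q u|) := by positivity
      have hw : 0 ≤ u ^ 2 * Real.exp (-(c * u ^ 2)) * |q u| := by positivity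
      calc _ ≤ E * E * (u * (1 + |q u|)) := by gcongr
        _ = E * E * u + E * E * u * |q u| := by ring
        _ ≤ 1 / c * E + 2 * (u ^ 2 * Real.exp (-(c * u ^ 2))) * |q u| := by gcongr
        _ ≤ _ := by nlinarith
    calc X ≤ ENNReal.ofReal (Real.exp (-(a * ρ ^ 2)))
          * (K * (L * ENNReal.ofReal (u * (1 + |q u|)))) := by
          refine mul_le_mul' le_rfl (hdouble.trans (mul_le_mul' le_rfl ?_))
          refine le_trans (measure_mono fun x (hx : δ x < ρ / 2) => ?_) (hV u (by linarith))
          exact hx.trans hu1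
      _ = K * L * ENNReal.ofReal (Real.exp (-(a * ρ ^ 2)) * (u * (1 + |q u|))) := by
          rw [ENNReal.ofReal_mul (Real.exp_pos _).le]
          ring
      _ ≤ K * L * ENNReal.ofReal ((1 / c + 2) *
            (E + u ^ 2 * Real.exp (-(c * u ^ 2)) * |q u|)) := by gcongr
      _ = _ := by
          rw [ENNReal.ofReal_mul (by positivity),
            ENNReal.ofReal_add (Real.exp_pos _).le (by positivity)]
          ring
  have hint : X * ENNReal.ofReal (1 / 2) ≤ K * L * ENNReal.ofReal (1 / c + 2) *
      (ENNReal.ofReal E * ENNReal.ofReal (1 / 2) + gaussIntegral q c (Ioo (ρ - 1 / 2) ρ)) := by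
    have hvol : volume (Ioo (ρ - 1 / 2) ρ) = ENNReal.ofReal (1 / 2) := by
      rw [Real.volume_Ioo]
      ring_nf
    have h := setLIntegral_mono' (μ := volume) measurableSet_Ioo hpt
    rwa [setLIntegral_const, lintegral_const_mul' _ _ (ENNReal.mul_ne_top
      (ENNReal.mul_ne_top hK hL) ENNReal.ofReal_ne_top), lintegral_add_left (by fun_prop),
      setLIntegral_const, hvol] at h
  have hhalf : ENNReal.ofReal (1 / 2) * 2 = 1 := by
    rw [← ENNReal.ofReal_ofNat, ← ENNReal.ofReal_mul (by norm_num)]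
    norm_num
  calc X = X * ENNReal.ofReal (1 / 2) * 2 := by rw [mul_assoc, hhalf, mul_one]
    _ ≤ K * L * ENNReal.ofReal (1 / c + 2) *
      (ENNReal.ofReal E * 1 + gaussIntegral q c (Ioo 0 ρ)) * 2 := by
        refine mul_le_mul' (hint.trans ?_) le_rfl
        gcongr
        · exact ENNReal.ofReal_le_one.mpr (by norm_num)
        · exact lintegral_mono_set (Ioo_subset_Ioo_left (by linarith))
    _ = _ := by ring

/-- Gaussian integrals over a sublevel set, under a doubling condition. -/
lemma lintegral_gaussian_sublevel_le_gaussIntegral [SFinite μ] (hδ : Measurable δ) (hδ0 : ∀ x, 0 ≤ δ x)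
    (hL : L ≠ ⊤) (hV : ∀ u, 0 < u → μ {x | δ x < u} ≤ L * ENNReal.ofReal (u * (1 + |q u|)))
    {K : ℝ≥0∞} (hK : K ≠ ⊤) {a c ρ : ℝ} (hc : 0 < c) (hca : 2 * c ≤ a) (hρ : 1 ≤ ρ)
    (hdouble : μ {x | δ x < ρ} ≤ K * μ {x | δ x < ρ / 2}) :
    ∫⁻ x in {x | δ x < ρ}, ENNReal.ofReal (Real.exp (-(a * δ x ^ 2))) ∂μ
      ≤ (ENNReal.ofReal (2 * a) * (gaussMoment c + 1) + 2 * K * ENNReal.ofReal (1 / c + 2)) *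
        (L * (gaussIntegral q c (Ioo 0 ρ) + 1)) := by
  have hM : ∫⁻ u in Ioo 0 ρ, ENNReal.ofReal (u ^ 2 * Real.exp (-(a * u ^ 2))) ≤ gaussMoment c := by
    refine (lintegral_mono_set Ioo_subset_Ioi_self).trans ?_
    simpa using lintegral_sq_gaussian_tail_le hc hca le_rfl
  have hE : ENNReal.ofReal (Real.exp (-(c * ρ ^ 2))) ≤ 1 := by
    rw [ENNReal.ofReal_le_one, Real.exp_le_one_iff]
    have : 0 ≤ c * ρ ^ 2 := by positivity
    linarith
  rw [lintegral_gaussian_sublevel hδ hδ0 (by linarith) (by linarith), add_mul]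
  refine add_le_add ?_ ((exp_mul_measure_le hL hV hK hc hca hρ hdouble).trans (by gcongr))
  refine (lintegral_weight_mul_measure_le hL hV (by linarith) (by linarith : c ≤ a)
    measurableSet_Ioo Ioo_subset_Ioi_self).trans ?_
  calc _ ≤ ENNReal.ofReal (2 * a) * L * (gaussMoment c + gaussIntegral q c (Ioo 0 ρ)) := by gcongr
    _ ≤ ENNReal.ofReal (2 * a) * L * (gaussMoment c + gaussIntegral q c (Ioo 0 ρ))
        + ENNReal.ofReal (2 * a) * L * (gaussMoment c * gaussIntegral q c (Ioo 0 ρ) + 1) :=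
          le_self_add
    _ = _ := by ring

/-- Upper bound for the deviation of a Gaussian integral from its value for `μ {δ < u} = L u`. -/
lemma lintegral_gaussian_sublevel_le_add [SFinite μ] (hδ : Measurable δ) (hδ0 : ∀ x, 0 ≤ δ x)
    (hL : L ≠ ⊤) (hV : ∀ u, 0 < u → μ {x | δ x < u} ≤ L * ENNReal.ofReal (u * (1 + |q u|)))
    {K : ℝ≥0∞} (hK : K ≠ ⊤) {c ρ : ℝ} (hc : 0 < c) (hc1 : 2 * c ≤ 1) (hρ : 1 ≤ ρ)
    (hdouble : μ {x | δ x < ρ} ≤ K * μ {x | δ x < ρ / 2}) :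
    ∫⁻ x in {x | δ x < ρ}, ENNReal.ofReal (Real.exp (-(δ x ^ 2))) ∂μ
      ≤ 2 * L * gaussMoment 1 + (2 + 2 * K * ENNReal.ofReal (1 / c + 2)) *
        (L * (gaussIntegral q c (Ioo 0 ρ) + ENNReal.ofReal (Real.exp (-(c * ρ ^ 2))))) := by
  have h := lintegral_gaussian_sublevel (μ := μ) hδ hδ0 one_pos (ρ := ρ) (by linarith)
  simp only [one_mul] at h
  rw [h]
  have h1 := lintegral_weight_mul_measure_le hL hV one_pos (by linarith : c ≤ 1)
    (measurableSet_Ioo (a := 0) (b := ρ)) Ioo_subset_Ioi_self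
  have h2 := exp_mul_measure_le hL hV hK hc hc1 hρ hdouble
  have h3 : ∫⁻ u in Ioo 0 ρ, ENNReal.ofReal (u ^ 2 * Real.exp (-(1 * u ^ 2))) ≤ gaussMoment 1 :=
    lintegral_mono_set Ioo_subset_Ioi_self
  simp only [one_mul, mul_one, ENNReal.ofReal_ofNat] at h1 h2 h3 ⊢
  set E := ENNReal.ofReal (Real.exp (-(c * ρ ^ 2)))
  calc _ ≤ 2 * L * (gaussMoment 1 + gaussIntegral q c (Ioo 0 ρ))
        + 2 * K * ENNReal.ofReal (1 / c + 2) * (L * (gaussIntegral q c (Ioo 0 ρ) + E)) :=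
          add_le_add (h1.trans (by gcongr)) h2
    _ ≤ 2 * L * (gaussMoment 1 + gaussIntegral q c (Ioo 0 ρ))
        + 2 * K * ENNReal.ofReal (1 / c + 2) * (L * (gaussIntegral q c (Ioo 0 ρ) + E))
        + 2 * L * E := le_self_add
    _ = _ := by ring

/-- Lower bound for the deviation of a Gaussian integral from its value for `μ {δ < u} = L u`. -/
lemma le_lintegral_gaussian_sublevel_add [SFinite μ] (hδ : Measurable δ) (hδ0 : ∀ x, 0 ≤ δ x)
    (hL : L ≠ ⊤)
    (hV : ∀ u, 0 < u → L * ENNReal.ofReal u ≤ μ {x | δ x < u} + L * ENNReal.ofReal (u * |q u|))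
    {c ρ : ℝ} (hc : 0 < c) (hc1 : 2 * c ≤ 1) (hρ : 0 < ρ) :
    2 * L * gaussMoment 1
      ≤ (∫⁻ x in {x | δ x < ρ}, ENNReal.ofReal (Real.exp (-(δ x ^ 2))) ∂μ)
        + 2 * (gaussMoment c + 1) *
        (L * (gaussIntegral q c (Ioo 0 ρ) + ENNReal.ofReal (Real.exp (-(c * ρ ^ 2))))) := by
  have h := lintegral_gaussian_sublevel (μ := μ) hδ hδ0 one_pos hρ
  simp only [one_mul, mul_one] at h
  have hmono : Monotone fun u => μ {x | δ x < u} := fun u v huv =>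
    measure_mono fun x (hx : δ x < u) => hx.trans_le huv
  have hpt : ∀ u ∈ Ioo 0 ρ, 2 * L * ENNReal.ofReal (u ^ 2 * Real.exp (-(1 * u ^ 2)))
      ≤ ENNReal.ofReal (2 * u * Real.exp (-u ^ 2)) * μ {x | δ x < u}
        + 2 * L * ENNReal.ofReal (u ^ 2 * Real.exp (-(c * u ^ 2)) * |q u|) := by
    intro u hu
    have hu0 : 0 < u := hu.1
    calc _ = ENNReal.ofReal (2 * u * Real.exp (-u ^ 2)) * (L * ENNReal.ofReal u) := by
          rw [mul_left_comm, ← ENNReal.ofReal_mul (by positivity), ← ENNReal.ofReal_ofNat 2,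
            mul_comm _ L, mul_assoc, ← ENNReal.ofReal_mul (by norm_num)]
          ring_nf
      _ ≤ ENNReal.ofReal (2 * u * Real.exp (-u ^ 2)) *
          (μ {x | δ x < u} + L * ENNReal.ofReal (u * |q u|)) := by
          gcongr
          exact hV u hu0
      _ = ENNReal.ofReal (2 * u * Real.exp (-u ^ 2)) * μ {x | δ x < u}
          + 2 * L * ENNReal.ofReal (u ^ 2 * Real.exp (-(1 * u ^ 2)) * |q u|) := by
          rw [mul_add, mul_left_comm, ← ENNReal.ofReal_mul (by positivity),
            ← ENNReal.ofReal_ofNat 2, mul_comm (ENNReal.ofReal 2) L, mul_assoc L,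
            ← ENNReal.ofReal_mul (by norm_num)]
          ring_nf
      _ ≤ _ := by
          gcongr
          linarith
  -- No measurability of `q` is assumed, so splitting the integral rests on this summand, measurable
  -- because `u ↦ μ {δ < u}` is monotone.
  have hgm : Measurable fun u => ENNReal.ofReal (2 * u * Real.exp (-u ^ 2)) * μ {x | δ x < u} :=
    (by fun_prop : Measurable fun u : ℝ =>
      ENNReal.ofReal (2 * u * Real.exp (-u ^ 2))).mul hmono.measurable
  have h1 := setLIntegral_mono' (μ := volume) measurableSet_Ioo hpt
  rw [lintegral_const_mul' _ _ (ENNReal.mul_ne_top (by norm_num) hL),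
    lintegral_add_left hgm,
    lintegral_const_mul' _ _ (ENNReal.mul_ne_top (by norm_num) hL)] at h1
  have h2 : gaussMoment 1 ≤ (∫⁻ u in Ioo 0 ρ, ENNReal.ofReal (u ^ 2 * Real.exp (-(1 * u ^ 2))))
      + ENNReal.ofReal (Real.exp (-(c * ρ ^ 2))) * gaussMoment c := by
    unfold gaussMoment
    rw [← Ioo_union_Ici_eq_Ioi hρ, lintegral_union measurableSet_Ici
      (disjoint_left.mpr fun u hu hu' => (not_le.mpr hu.2) hu'), Ioo_union_Ici_eq_Ioi hρ,
      setLIntegral_congr (f := fun u => ENNReal.ofReal (u ^ 2 * Real.exp (-(1 * u ^ 2))))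
      (Ioi_ae_eq_Ici (a := ρ)).symm]
    gcongr
    exact lintegral_sq_gaussian_tail_le hc hc1 hρ.le
  set E := ENNReal.ofReal (Real.exp (-(c * ρ ^ 2)))
  set J := gaussIntegral q c (Ioo 0 ρ) with hJ
  unfold gaussIntegral at hJ
  rw [← hJ] at h1
  calc _ ≤ 2 * L * ((∫⁻ u in Ioo 0 ρ, ENNReal.ofReal (u ^ 2 * Real.exp (-(1 * u ^ 2))))
        + E * gaussMoment c) := by gcongr
    _ = 2 * L * (∫⁻ u in Ioo 0 ρ, ENNReal.ofReal (u ^ 2 * Real.exp (-(1 * u ^ 2))))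
        + 2 * L * (E * gaussMoment c) := mul_add _ _ _
    _ ≤ ((∫⁻ x in {x | δ x < ρ}, ENNReal.ofReal (Real.exp (-(δ x ^ 2))) ∂μ) + 2 * L * J)
        + 2 * L * (E * gaussMoment c) := by
        -- In the lower bound the boundary term at `ρ` has the favourable sign and is dropped; no
        -- doubling is needed.
        refine add_le_add (h1.trans (add_le_add ?_ le_rfl)) le_rfl
        rw [h]
        exact le_self_add
    _ ≤ ((∫⁻ x in {x | δ x < ρ}, ENNReal.ofReal (Real.exp (-(δ x ^ 2))) ∂μ) + 2 * L * J)
        + 2 * L * (E * gaussMoment c) + 2 * L * (J * gaussMoment c + E) := le_self_add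
    _ = _ := by ring

end LayerCake

/-! ### Nearest points and the doubling property of the inner collar -/

/-- The nearest-point map to a set is monotone. -/
lemma inner_sub_nearest_nonneg {V : Type*} [NormedAddCommGroup V] [InnerProductSpace ℝ V]
    {x z p q : V} (hx : ‖x - p‖ ≤ ‖x - q‖) (hz : ‖z - q‖ ≤ ‖z - p‖) :
    0 ≤ ⟪x - z, p - q⟫_ℝ := by
  have h1 : ‖x - p‖ ^ 2 ≤ ‖x - q‖ ^ 2 := by gcongr
  have h2 : ‖z - q‖ ^ 2 ≤ ‖z - p‖ ^ 2 := by gcongr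
  rw [norm_sub_sq_real, norm_sub_sq_real] at h1 h2
  simp only [inner_sub_left, inner_sub_right]
  linarith

/-- Moving points half way to a nearest point of a set shrinks distances at most by `2`. -/
lemma antilipschitz_midpoint_nearest {V : Type*} [NormedAddCommGroup V] [InnerProductSpace ℝ V]
    {p : V → V} (hp : ∀ x z, ‖x - p x‖ ≤ ‖x - p z‖) :
    AntilipschitzWith 2 fun x => (2⁻¹ : ℝ) • (x + p x) := by
  refine AntilipschitzWith.of_le_mul_dist fun x z => ?_
  have h := inner_sub_nearest_nonneg (hp x z) (hp z x)
  have e : (2⁻¹ : ℝ) • (x + p x) - (2⁻¹ : ℝ) • (z + p z)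
      = (2⁻¹ : ℝ) • ((x - z) + (p x - p z)) := by
    rw [← smul_sub]
    congr 1
    abel
  rw [dist_eq_norm, dist_eq_norm, e, norm_smul]
  -- By monotonicity the cross term in the expanded square is nonnegative.
  have h1 : ‖x - z‖ ^ 2 ≤ ‖(x - z) + (p x - p z)‖ ^ 2 := by
    rw [norm_add_sq_real]
    nlinarith [sq_nonneg ‖p x - p z‖]
  have h2 := le_of_sq_le_sq h1 (norm_nonneg _)
  simpa using h2

/-- Hausdorff measure obeys this scaling for arbitrary sets, so neither continuity of `f` nor
measurability of the image is needed; nearest-point choices provide neither. -/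
lemma volume_le_of_antilipschitz {d : ℕ} {f : Euc d → Euc d} {K : NNReal}
    (hf : AntilipschitzWith K f) (s : Set (Euc d)) :
    volume s ≤ (K : ℝ≥0∞) ^ d * volume (f '' s) := by
  have h := hf.le_hausdorffMeasure_image (d := (d : ℝ)) (Nat.cast_nonneg d) s
  rw [ENNReal.rpow_natCast] at h
  rw [← EuclideanSpace.euclideanHausdorffMeasure_eq_volume,
    Measure.euclideanHausdorffMeasure_def, Measure.smul_apply, Measure.smul_apply]
  calc _ ≤ _ • ((K : ℝ≥0∞) ^ d * Measure.hausdorffMeasure (d : ℝ) (f '' s)) := by gcongr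
    _ = _ := by simp only [ENNReal.smul_def, smul_eq_mul]; ring

lemma bdryDist_pos {d : ℕ} {Ω : Set (Euc d)} (hΩ : IsOpen Ω) (hne : Ωᶜ.Nonempty) {x : Euc d}
    (hx : x ∈ Ω) : 0 < bdryDist Ω x :=
  (hΩ.isClosed_compl.notMem_iff_infDist_pos hne).mp (by simpa using hx)

/-- The volume of the inner collar of width `r` grows at most like that of a cone. -/
theorem volume_collar_le {d : ℕ} {Ω : Set (Euc d)} (hΩ : IsOpen Ω) (hne : Ωᶜ.Nonempty) (r : ℝ) :
    volume {x ∈ Ω | bdryDist Ω x < r} ≤ 2 ^ d * volume {x ∈ Ω | bdryDist Ω x < r / 2} := by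
  choose p hpmem hp using fun x : Euc d => hΩ.isClosed_compl.exists_infDist_eq_dist hne x
  have hp' : ∀ x z, ‖x - p x‖ ≤ ‖x - p z‖ := fun x z => by
    rw [← dist_eq_norm, ← dist_eq_norm, ← hp]
    exact Metric.infDist_le_dist_of_mem (hpmem z)
  refine (volume_le_of_antilipschitz (antilipschitz_midpoint_nearest hp') _).trans ?_
  refine mul_le_mul' le_rfl (measure_mono ?_)
  rintro _ ⟨x, ⟨hx, hxr⟩, rfl⟩
  have hpos := bdryDist_pos hΩ hne hx
  unfold bdryDist at *
  set y := (2⁻¹ : ℝ) • (x + p x)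
  have e1 : dist y (p x) = dist x (p x) / 2 := by
    have : y - p x = (2⁻¹ : ℝ) • (x - p x) := by module
    rw [dist_eq_norm, this, norm_smul, dist_eq_norm]
    norm_num
    ring
  have e2 : dist x y = dist x (p x) / 2 := by
    have : x - y = (2⁻¹ : ℝ) • (x - p x) := by module
    rw [dist_eq_norm, this, norm_smul, dist_eq_norm]
    norm_num
    ring
  -- The midpoint `y` lies at distance `d_Ω(x)/2` from both `p x` and `x`: the first puts it in the
  -- half-width collar, the second keeps it inside `Ω`.
  have hle : Metric.infDist y Ωᶜ ≤ dist y (p x) := Metric.infDist_le_dist_of_mem (hpmem x)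
  have hge : Metric.infDist x Ωᶜ ≤ Metric.infDist y Ωᶜ + dist x y :=
    Metric.infDist_le_infDist_add_dist
  rw [← hp] at e1 e2
  refine ⟨?_, lt_of_le_of_lt (hle.trans_eq e1) (by linarith)⟩
  by_contra hy
  have : Metric.infDist y Ωᶜ = 0 := Metric.infDist_zero_of_mem hy
  linarith

/-! ### The trace as the integral of a diagonal density -/

/-- Distinct vectors are `√2` apart, so the balls of radius `1/2` are disjoint. Countability permits
exchanging sum and integral and uniting null sets below. -/
lemma countable_of_orthonormal {H ι : Type*} [NormedAddCommGroup H] [InnerProductSpace ℂ H]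
    [TopologicalSpace.SeparableSpace H] {b : ι → H} (hb : Orthonormal ℂ b) : Countable ι := by
  refine Pairwise.countable_of_isOpen_disjoint (s := fun i => Metric.ball (b i) 2⁻¹)
    (fun i j hij => ?_) (fun i => Metric.isOpen_ball) (fun i => ⟨b i, by simp⟩)
  refine Metric.ball_disjoint_ball ?_
  have h : dist (b i) (b j) ^ 2 = 2 := by
    rw [dist_eq_norm, @norm_sub_sq ℂ, hb.2 hij, hb.1 i, hb.1 j]
    norm_num
  nlinarith [dist_nonneg (x := b i) (y := b j)]

lemma exists_eq_star_mul_self {H : Type*} [NormedAddCommGroup H] [InnerProductSpace ℂ H]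
    [CompleteSpace H] {T : H →L[ℂ] H} (hT : T.IsPositive) : ∃ S : H →L[ℂ] H, T = star S * S :=
  CStarAlgebra.nonneg_iff_eq_star_mul_self.mp
    ((ContinuousLinearMap.nonneg_iff_isPositive T).mpr hT)

lemma isPositive_heatSemigroup {d : ℕ} (Ω : Set (Euc d)) (t : ℝ) :
    (heatSemigroup Ω t).IsPositive := by
  rw [← ContinuousLinearMap.nonneg_iff_isPositive]
  refine cfc_nonneg fun x _ => ?_
  unfold heatFun
  split_ifs <;> positivity

lemma ofReal_norm_sq_eq_enorm_sq {E : Type*} [SeminormedAddCommGroup E] (z : E) :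
    ENNReal.ofReal (‖z‖ ^ 2) = ‖z‖ₑ ^ 2 := by
  rw [ENNReal.ofReal_pow (norm_nonneg _), ofReal_norm]

/-- Jensen's inequality for the square of a mean. -/
lemma enorm_average_sq_le {α : Type*} [MeasurableSpace α] {μ : Measure α} [IsFiniteMeasure μ]
    {f : α → ℂ} (hf : AEStronglyMeasurable f μ) :
    ‖⨍ x, f x ∂μ‖ₑ ^ 2 ≤ (∫⁻ x, ‖f x‖ₑ ^ 2 ∂μ) / μ univ := by
  rcases eq_or_ne μ 0 with rfl | hμ
  · simp
  have : NeZero μ := ⟨hμ⟩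
  rw [average]
  set ν := (μ univ)⁻¹ • μ
  have hν : IsProbabilityMeasure ν := isProbabilityMeasureSMul
  have h1 : ‖∫ x, f x ∂ν‖ₑ ≤ eLpNorm f 2 ν := by
    refine (enorm_integral_le_lintegral_enorm _).trans ?_
    rw [← eLpNorm_one_eq_lintegral_enorm]
    exact eLpNorm_le_eLpNorm_of_exponent_le (by norm_num) (hf.smul_measure _)
  calc _ ≤ eLpNorm f 2 ν ^ 2 := by gcongr
    _ = ∫⁻ x, ‖f x‖ₑ ^ 2 ∂ν := by
      rw [eLpNorm_eq_lintegral_rpow_enorm_toReal (by norm_num) (by norm_num), ← ENNReal.rpow_natCast,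
        ← ENNReal.rpow_mul]
      simp
    _ = _ := by rw [lintegral_smul_measure, smul_eq_mul, mul_comm, div_eq_mul_inv]

lemma norm_inner_ballAverage {d : ℕ} {Ω : Set (Euc d)} {x : Euc d} {ε : ℝ}
    (h : Metric.closedBall x ε ⊆ Ω) (f : L2 Ω) :
    ‖⟪f, ballAverage Ω x ε⟫_ℂ‖
      = ‖⨍ y in Metric.closedBall x ε, f y ∂(volume.restrict Ω)‖ := by
  rw [norm_inner_symm, ballAverage, L2.inner_indicatorConstLp_eq_inner_setIntegral, setAverage_eq,
    measureReal_restrict_apply measurableSet_closedBall, inter_eq_self_of_subset_left h]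
  simp [mul_comm]

/-- A positive operator on `L²(Ω)` has a density on the diagonal, whose integral is the trace. It is
bounded by the lower limit of the means of the kernel, with equality if the trace is finite. -/
theorem exists_diagonal_density {d : ℕ} {Ω : Set (Euc d)} (hΩ : IsOpen Ω) (hfin : volume Ω ≠ ⊤)
    {T : L2 Ω →L[ℂ] L2 Ω} (hT : T.IsPositive) :
    ∃ h : Euc d → ℝ≥0∞, Measurable h ∧ ∫⁻ x in Ω, h x = posTrace T ∧
      (∀ᵐ x ∂(volume.restrict Ω), (h x : EReal) ≤ liminf (fun ε : ℝ =>
        ((RCLike.re ⟪ballAverage Ω x ε, T (ballAverage Ω x ε)⟫_ℂ : ℝ) : EReal)) (𝓝[>] 0)) ∧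
      (posTrace T ≠ ⊤ → ∀ᵐ x ∂(volume.restrict Ω), liminf (fun ε : ℝ =>
        ((RCLike.re ⟪ballAverage Ω x ε, T (ballAverage Ω x ε)⟫_ℂ : ℝ) : EReal)) (𝓝[>] 0)
          ≤ (h x : EReal)) := by
  have : Fact (volume Ω < ⊤) := ⟨hfin.lt_top⟩
  obtain ⟨S, rfl⟩ := exists_eq_star_mul_self hT
  have hre : ∀ x : L2 Ω, RCLike.re ⟪x, (star S * S) x⟫_ℂ = ‖S x‖ ^ 2 := fun x => by
    rw [ContinuousLinearMap.star_eq_adjoint, mul_apply_eq_comp,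
      ContinuousLinearMap.adjoint_inner_right, inner_self_eq_norm_sq]
  obtain ⟨w, b, -⟩ := exists_hilbertBasis ℂ (L2 Ω)
  have : Fact ((2 : ℝ≥0∞) ≠ ⊤) := ⟨by norm_num⟩
  have hcount : Countable w := countable_of_orthonormal b.orthonormal
  -- Since `T f = ∑ ⟨F i, f⟩ F i`, the kernel of `T` is formally `∑ F i (x) conj (F i (y))`, with
  -- diagonal `∑ |F i|²`.
  set F : w → L2 Ω := fun i => ContinuousLinearMap.adjoint S (b i)
  have hFm : ∀ i, Measurable fun x => ‖F i x‖ₑ ^ 2 := fun i =>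
    ((Lp.stronglyMeasurable (F i)).measurable.enorm).pow_const 2
  have hFint : ∀ i, Integrable (F i) (volume.restrict Ω) := fun i =>
    (Lp.memLp (F i)).integrable (by norm_num)
  have htr : ∫⁻ x in Ω, ∑' i, ‖F i x‖ₑ ^ 2 = posTrace (star S * S) := by
    rw [lintegral_tsum fun i => (hFm i).aemeasurable, posTrace_eq hT b]
    simp_rw [hre]
    rw [tsum_norm_sq_adjoint S b b]
    refine tsum_congr fun i => ?_
    rw [← @inner_self_eq_norm_sq ℂ, L2.inner_def]
    have h1 := (Lp.memLp (F i)).integrable_norm_pow (by norm_num)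
    change _ = ENNReal.ofReal (RCLike.re (∫ x in Ω, ⟪F i x, F i x⟫_ℂ))
    have h2 : ∫ x in Ω, ⟪F i x, F i x⟫_ℂ = ((∫ x in Ω, ‖F i x‖ ^ 2 : ℝ) : ℂ) := by
      rw [← integral_complex_ofReal]
      refine integral_congr_ae (ae_of_all _ fun x => ?_)
      simp [inner_self_eq_norm_sq_to_K]
    rw [h2]
    change _ = ENNReal.ofReal (∫ x in Ω, ‖F i x‖ ^ 2)
    rw [ofReal_integral_eq_lintegral_ofReal h1 (ae_of_all _ fun x => by positivity)]
    simp_rw [ofReal_norm_sq_eq_enorm_sq]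
  have hball : ∀ x ∈ Ω, ∀ᶠ ε in 𝓝[>] (0 : ℝ), Metric.closedBall x ε ⊆ Ω := fun x hx => by
    obtain ⟨ρ, hρ, hsub⟩ := Metric.isOpen_iff.mp hΩ x hx
    filter_upwards [Ioo_mem_nhdsGT hρ] with ε hε
    exact (Metric.closedBall_subset_ball hε.2).trans hsub
  -- Parseval: the form at a ball average is the sum of the squared means of the `F i`.
  have hQ : ∀ x ∈ Ω, ∀ᶠ ε in 𝓝[>] (0 : ℝ),
      ((RCLike.re ⟪ballAverage Ω x ε, (star S * S) (ballAverage Ω x ε)⟫_ℂ : ℝ) : EReal)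
        = ((∑' i, ‖⨍ y in Metric.closedBall x ε, F i y ∂(volume.restrict Ω)‖ₑ ^ 2 : ℝ≥0∞) : EReal) :=
    fun x hx => by
      filter_upwards [hball x hx] with ε hε
      have h1 : ENNReal.ofReal (‖S (ballAverage Ω x ε)‖ ^ 2)
          = ∑' i, ‖⨍ y in Metric.closedBall x ε, F i y ∂(volume.restrict Ω)‖ₑ ^ 2 := by
        rw [ofReal_norm_sq_eq_tsum b]
        refine tsum_congr fun i => ?_
        rw [← ContinuousLinearMap.adjoint_inner_left, norm_inner_ballAverage hε,
          ofReal_norm_sq_eq_enorm_sq]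
      rw [hre, ← h1, EReal.coe_ennreal_ofReal, max_eq_left (by positivity)]
  refine ⟨fun x => ∑' i, ‖F i x‖ₑ ^ 2, Measurable.tsum hFm, htr, ?_, fun hne => ?_⟩
  · have hdiff : ∀ᵐ x ∂(volume.restrict Ω), ∀ i, Tendsto
        (fun ε => ⨍ y in Metric.closedBall x ε, F i y ∂(volume.restrict Ω)) (𝓝[>] 0)
        (𝓝 (F i x)) := by
      rw [ae_all_iff]
      intro i
      filter_upwards [(Besicovitch.vitaliFamily (volume.restrict Ω)).ae_tendsto_average
        (hFint i).locallyIntegrable] with x hx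
      exact hx.comp (Besicovitch.tendsto_filterAt _ x)
    filter_upwards [hdiff, ae_restrict_mem hΩ.measurableSet] with x hx hxΩ
    rw [liminf_congr (hQ x hxΩ)]
    set L := liminf (fun ε : ℝ => ((∑' i,
      ‖⨍ y in Metric.closedBall x ε, F i y ∂(volume.restrict Ω)‖ₑ ^ 2 : ℝ≥0∞) : EReal)) (𝓝[>] 0)
    -- As in Fatou's lemma: finite partial sums pass to the limit at Lebesgue points of all `F i`,
    -- then the supremum over `s` is taken.
    have hs : ∀ s : Finset w, ((∑ i ∈ s, ‖F i x‖ₑ ^ 2 : ℝ≥0∞) : EReal) ≤ L := fun s => by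
      have ht : Tendsto (fun ε => ((∑ i ∈ s,
          ‖⨍ y in Metric.closedBall x ε, F i y ∂(volume.restrict Ω)‖ₑ ^ 2 : ℝ≥0∞) : EReal))
          (𝓝[>] 0) (𝓝 ((∑ i ∈ s, ‖F i x‖ₑ ^ 2 : ℝ≥0∞) : EReal)) := by
        refine (continuous_coe_ennreal_ereal.tendsto _).comp ?_
        refine tendsto_finsetSum _ fun i _ => ?_
        exact ((ENNReal.continuous_pow 2).tendsto _).comp ((hx i).enorm)
      rw [← ht.liminf_eq]
      refine liminf_le_liminf (Eventually.of_forall fun ε => ?_)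
      exact EReal.coe_ennreal_le_coe_ennreal_iff.mpr (ENNReal.sum_le_tsum s)
    have hL : 0 ≤ L := by simpa using hs ∅
    rw [← EReal.coe_toENNReal hL] at hs ⊢
    simp only [EReal.coe_ennreal_le_coe_ennreal_iff] at hs ⊢
    exact ENNReal.summable.tsum_le_of_sum_le hs
  -- Jensen bounds the squared means by the means of `h = ∑ |F i|²`. These converge to `h` almost
  -- everywhere because `h` is integrable, which is the finiteness of the trace.
  · rw [← htr] at hne
    filter_upwards [(Besicovitch.vitaliFamily (volume.restrict Ω)).ae_tendsto_lintegral_div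
      (Measurable.tsum hFm).aemeasurable hne, ae_restrict_mem hΩ.measurableSet] with x hx hxΩ
    rw [liminf_congr (hQ x hxΩ)]
    have ht := (continuous_coe_ennreal_ereal.tendsto _).comp
      (hx.comp (Besicovitch.tendsto_filterAt _ x))
    rw [← ht.liminf_eq]
    refine liminf_le_liminf (Eventually.of_forall fun ε => ?_)
    refine EReal.coe_ennreal_le_coe_ennreal_iff.mpr ?_
    rw [Function.comp_apply, lintegral_tsum fun i => (hFm i).aemeasurable, div_eq_mul_inv, ← ENNReal.tsum_mul_right]
    refine ENNReal.tsum_le_tsum fun i => ?_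
    have h := enorm_average_sq_le (μ := (volume.restrict Ω).restrict (Metric.closedBall x ε))
      (Lp.stronglyMeasurable (F i)).aestronglyMeasurable
    rwa [Measure.restrict_apply_univ, div_eq_mul_inv] at h

/-- This excludes `-∞`, so that `toReal` is faithful as soon as `+∞` is excluded too. -/
lemma heatKernel_self_nonneg {d : ℕ} (Ω : Set (Euc d)) (t : ℝ) (x : Euc d) :
    0 ≤ heatKernel Ω t x x := by
  refine le_liminf_of_le (by isBoundedDefault) (Eventually.of_forall fun ε => ?_)
  exact EReal.coe_nonneg.mpr ((isPositive_heatSemigroup Ω t).re_inner_nonneg_right _)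

/-- Pointwise bounds for the heat kernel on the diagonal imply bounds for the heat trace. -/
theorem heatTrace_comparison {d : ℕ} {Ω : Set (Euc d)} (hΩ : IsOpen Ω) (hfin : volume Ω ≠ ⊤)
    {t N : ℝ} (hN : 0 < N) {w D : Euc d → ℝ} (hw : Measurable w)
    (htop : ∀ x ∈ Ω, heatKernel Ω t x x ≠ ⊤)
    (hD : ∀ x ∈ Ω, |N * (heatKernel Ω t x x).toReal - w x| ≤ D x) :
    ENNReal.ofReal N * heatTrace Ω t
        ≤ (∫⁻ x in Ω, ENNReal.ofReal (w x)) + ∫⁻ x in Ω, ENNReal.ofReal (D x) ∧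
      ∫⁻ x in Ω, ENNReal.ofReal (w x)
        ≤ ENNReal.ofReal N * heatTrace Ω t + ∫⁻ x in Ω, ENNReal.ofReal (D x) := by
  obtain ⟨h, hm, hint, hle, hge⟩ :=
    exists_diagonal_density hΩ hfin (isPositive_heatSemigroup Ω t)
  have hk : ∀ x ∈ Ω, heatKernel Ω t x x
      = ((ENNReal.ofReal (heatKernel Ω t x x).toReal : ℝ≥0∞) : EReal) := fun x hx => by
    have h0 := heatKernel_self_nonneg Ω t x
    rw [EReal.coe_ennreal_ofReal, max_eq_left (EReal.toReal_nonneg h0),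
      EReal.coe_toReal (htop x hx) (ne_of_gt (lt_of_lt_of_le (by simp) h0))]
  have hNh : ∫⁻ x in Ω, ENNReal.ofReal N * h x = ENNReal.ofReal N * heatTrace Ω t := by
    rw [lintegral_const_mul _ hm, hint]
    rfl
  constructor
  · rw [← hNh, ← lintegral_add_left hw.ennreal_ofReal]
    refine lintegral_mono_ae ?_
    filter_upwards [hle, ae_restrict_mem hΩ.measurableSet] with x hx hxΩ
    change (h x : EReal) ≤ heatKernel Ω t x x at hx
    rw [hk x hxΩ, EReal.coe_ennreal_le_coe_ennreal_iff] at hx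
    have hd := (abs_le.mp (hD x hxΩ)).2
    calc _ ≤ ENNReal.ofReal N * ENNReal.ofReal (heatKernel Ω t x x).toReal := by gcongr
      _ = ENNReal.ofReal (N * (heatKernel Ω t x x).toReal) := (ENNReal.ofReal_mul hN.le).symm
      _ ≤ ENNReal.ofReal (w x + D x) := ENNReal.ofReal_le_ofReal (by linarith)
      _ ≤ _ := ENNReal.ofReal_add_le
  -- The bound of the kernel by the density is available only for finite trace; otherwise the claim
  -- is trivial.
  · by_cases hT : heatTrace Ω t = ⊤
    · rw [hT, ENNReal.mul_top (by simpa using hN)]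
      simp
    rw [← hNh, ← lintegral_add_left (hm.const_mul _)]
    refine lintegral_mono_ae ?_
    filter_upwards [hge hT, ae_restrict_mem hΩ.measurableSet] with x hx hxΩ
    change heatKernel Ω t x x ≤ (h x : EReal) at hx
    rw [hk x hxΩ, EReal.coe_ennreal_le_coe_ennreal_iff] at hx
    have hd := (abs_le.mp (hD x hxΩ)).1
    calc _ ≤ ENNReal.ofReal (N * (heatKernel Ω t x x).toReal + D x) :=
          ENNReal.ofReal_le_ofReal (by linarith)
      _ ≤ ENNReal.ofReal (N * (heatKernel Ω t x x).toReal) + ENNReal.ofReal (D x) :=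
          ENNReal.ofReal_add_le
      _ = ENNReal.ofReal N * ENNReal.ofReal (heatKernel Ω t x x).toReal + ENNReal.ofReal (D x) := by
          rw [ENNReal.ofReal_mul hN.le]
      _ ≤ _ := by gcongr

/-! ### Essential suprema and differences in the extended reals -/

/-- The essential bound holds almost everywhere even for non-measurable `E`; only `g` must be
measurable to extract the constant. -/
lemma lintegral_mul_le_eLpNorm_top_mul {α : Type*} [MeasurableSpace α] {ν : Measure α} {κ : ℝ}
    (hκ : 0 ≤ κ) (E : α → ℝ) {g : α → ℝ} (hg : Measurable g) (hg0 : ∀ x, 0 ≤ g x) :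
    ∫⁻ x, ENNReal.ofReal (κ * E x * g x) ∂ν
      ≤ ENNReal.ofReal κ * (eLpNorm E ⊤ ν * ∫⁻ x, ENNReal.ofReal (g x) ∂ν) := by
  rw [← mul_assoc, ← lintegral_const_mul _ hg.ennreal_ofReal, eLpNorm_exponent_top]
  refine lintegral_mono_ae ?_
  filter_upwards [enorm_ae_le_eLpNormEssSup E ν] with x hx
  rw [ENNReal.ofReal_mul' (hg0 x), ENNReal.ofReal_mul hκ]
  gcongr
  refine le_trans ?_ hx
  rw [← ofReal_norm]
  exact ENNReal.ofReal_le_ofReal (le_abs_self _)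

/-- A finite `R` forces a finite `T`, which reduces the claim to real numbers. -/
lemma abs_coe_sub_sub_le {T v m R : ℝ≥0∞} (hv : v ≠ ⊤) (hm : m ≠ ⊤) (h1 : T ≤ v + m + R)
    (h2 : v + m ≤ T + R) : ((T : EReal) - (v : EReal) - (m : EReal)).abs ≤ R := by
  by_cases hR : R = ⊤
  · rw [hR]
    exact le_top
  have hT : T ≠ ⊤ := ne_top_of_le_ne_top (by finiteness) h1
  lift T to NNReal using hT
  lift v to NNReal using hv
  lift m to NNReal using hm
  lift R to NNReal using hR
  have e : ((T : ℝ≥0∞) : EReal) - ((v : ℝ≥0∞) : EReal) - ((m : ℝ≥0∞) : EReal)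
      = (((T : ℝ) - v - m : ℝ) : EReal) := rfl
  rw [e, EReal.abs_def, ← ENNReal.ofReal_coe_nnreal]
  refine ENNReal.ofReal_le_ofReal ?_
  have h1' : T ≤ v + m + R := by exact_mod_cast h1
  have h2' : v + m ≤ T + R := by exact_mod_cast h2
  rw [← NNReal.coe_le_coe] at h1' h2'
  push_cast at h1' h2'
  rw [abs_le]
  constructor <;> linarith

/-! ### The rescaled inner collar -/

/-- The volume of the inner collar in terms of `ϑ_Ω`. -/
lemma volume_real_collar {d : ℕ} {Ω : Set (Euc d)} (hP0 : perim Ω ≠ 0) (hP : perim Ω ≠ ⊤) {s : ℝ}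
    (hs : 0 < s) : volume.real {x ∈ Ω | bdryDist Ω x < s}
      = s * (perim Ω).toReal * (1 + vartheta Ω s) := by
  have : 0 < (perim Ω).toReal := ENNReal.toReal_pos hP0 hP
  unfold vartheta
  field_simp
  ring

lemma setOf_scaled_bdryDist_lt {d : ℕ} (Ω : Set (Euc d)) {t : ℝ} (ht : 0 < t) (u : ℝ) :
    {x | bdryDist Ω x / √t < u} ∩ Ω = {x ∈ Ω | bdryDist Ω x < u * √t} := by
  ext x
  simp only [mem_inter_iff, mem_ofPred_eq, div_lt_iff₀ (Real.sqrt_pos.mpr ht)]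
  tauto

lemma measurable_bdryDist {d : ℕ} (Ω : Set (Euc d)) : Measurable (bdryDist Ω) :=
  (Metric.continuous_infDist_pt _).measurable

section Collar

variable {d : ℕ} {Ω : Set (Euc d)} {t : ℝ}

lemma restrict_scaled_bdryDist_lt (ht : 0 < t) (u : ℝ) :
    volume.restrict Ω {x | bdryDist Ω x / √t < u}
      = volume {x ∈ Ω | bdryDist Ω x < u * √t} := by
  rw [Measure.restrict_apply (measurableSet_lt ((measurable_bdryDist Ω).div_const _)
    measurable_const), setOf_scaled_bdryDist_lt Ω ht]

/-- The volume equals `L u (1 + q(u))` with `L = √t H^{d-1}(∂Ω)` and `q(u) = ϑ_Ω(u√t)`. This bound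
and the next are its two halves in the subtraction-free form of the layer cake hypotheses. -/
lemma collar_le (hfin : volume Ω ≠ ⊤) (hP0 : perim Ω ≠ 0) (hP : perim Ω ≠ ⊤) (ht : 0 < t) {u : ℝ}
    (hu : 0 < u) : volume.restrict Ω {x | bdryDist Ω x / √t < u}
      ≤ ENNReal.ofReal √t * perim Ω * ENNReal.ofReal (u * (1 + |vartheta Ω (u * √t)|)) := by
  have hst := Real.sqrt_pos.mpr ht
  rw [restrict_scaled_bdryDist_lt ht, ← ofReal_measureReal (measure_ne_top_of_subset
    (fun x hx => hx.1) hfin), volume_real_collar hP0 hP (mul_pos hu hst),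
    ← ENNReal.ofReal_toReal hP, ← ENNReal.ofReal_mul hst.le, ENNReal.toReal_ofReal
    ENNReal.toReal_nonneg, ← ENNReal.ofReal_mul (by positivity)]
  refine ENNReal.ofReal_le_ofReal ?_
  calc _ = √t * (perim Ω).toReal * (u * (1 + vartheta Ω (u * √t))) := by ring
    _ ≤ _ := by
      gcongr
      exact le_abs_self _

lemma le_collar_add (hfin : volume Ω ≠ ⊤) (hP0 : perim Ω ≠ 0) (hP : perim Ω ≠ ⊤) (ht : 0 < t)
    {u : ℝ} (hu : 0 < u) : ENNReal.ofReal √t * perim Ω * ENNReal.ofReal u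
      ≤ volume.restrict Ω {x | bdryDist Ω x / √t < u}
        + ENNReal.ofReal √t * perim Ω * ENNReal.ofReal (u * |vartheta Ω (u * √t)|) := by
  have hst := Real.sqrt_pos.mpr ht
  rw [restrict_scaled_bdryDist_lt ht, ← ofReal_measureReal (measure_ne_top_of_subset
    (fun x hx => hx.1) hfin), volume_real_collar hP0 hP (mul_pos hu hst),
    ← ENNReal.ofReal_toReal hP, ← ENNReal.ofReal_mul hst.le, ENNReal.toReal_ofReal
    ENNReal.toReal_nonneg, ← ENNReal.ofReal_mul (by positivity),
    ← ENNReal.ofReal_mul (by positivity)]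
  refine le_trans (ENNReal.ofReal_le_ofReal ?_) ENNReal.ofReal_add_le
  have h : 0 ≤ √t * (perim Ω).toReal * u
      * (|vartheta Ω (u * √t)| + vartheta Ω (u * √t)) := by
    have := neg_abs_le (vartheta Ω (u * √t))
    have : 0 ≤ |vartheta Ω (u * √t)| + vartheta Ω (u * √t) := by linarith
    positivity
  linarith

lemma collar_doubling (hΩ : IsOpen Ω) (hne : Ωᶜ.Nonempty) (ht : 0 < t) (ρ : ℝ) :
    volume.restrict Ω {x | bdryDist Ω x / √t < ρ}
      ≤ 2 ^ d * volume.restrict Ω {x | bdryDist Ω x / √t < ρ / 2} := by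
  rw [restrict_scaled_bdryDist_lt ht, restrict_scaled_bdryDist_lt ht, div_mul_eq_mul_div]
  exact volume_collar_le hΩ hne _

end Collar

/-! ### Assembling the errors and constants -/

lemma norm_factor_mul {d : ℕ} {t : ℝ} (ht : 0 < t) :
    (4 * Real.pi * t) ^ ((d : ℝ) / 2) * t ^ (-(d : ℝ) / 2) = (4 * Real.pi) ^ ((d : ℝ) / 2) ∧
      (4 * Real.pi * t) ^ ((d : ℝ) / 2) * (4 * Real.pi * t) ^ (-(d : ℝ) / 2) = 1 := by
  have hpi := Real.pi_pos
  constructor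
  · rw [Real.mul_rpow (by positivity) ht.le, mul_assoc, ← Real.rpow_add ht]
    simp [neg_div]
  · rw [← Real.rpow_add (by positivity)]
    simp [neg_div]

/-- Rescaling a pointwise kernel bound. -/
lemma abs_mul_sub_le_of_abs_sub_le {N T F k w B κ : ℝ} (hN : 0 ≤ N) (hNT : N * T = κ)
    (hNF : N * F = 1) (h : |k - F * w| ≤ T * B) : |N * k - w| ≤ κ * B := by
  have e : N * k - w = N * (k - F * w) := by
    rw [mul_sub, ← mul_assoc, hNF, one_mul]
  rw [e, abs_mul, abs_of_nonneg hN, ← hNT, mul_assoc]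
  gcongr

/-- The constant in the heat trace estimate. -/
noncomputable def traceConst (d : ℕ) (c₁ c₂ c : ℝ) : ℝ≥0∞ :=
  ENNReal.ofReal ((4 * Real.pi) ^ ((d : ℝ) / 2) + 2)
    * (ENNReal.ofReal (2 * c₁) * (gaussMoment c + 1)
      + (ENNReal.ofReal (2 * c₂) * (gaussMoment c + 1) + 2 * 2 ^ d * ENNReal.ofReal (1 / c + 2)) + 1)
    + (2 + 2 * 2 ^ d * ENNReal.ofReal (1 / c + 2)) + 2 * (gaussMoment c + 1)

lemma traceConst_ne_top {d : ℕ} {c₁ c₂ c : ℝ} (hc : 0 < c) : traceConst d c₁ c₂ c ≠ ⊤ := by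
  have := gaussMoment_ne_top hc
  unfold traceConst
  finiteness

/-- Integral of the pointwise error bound over the three regions. -/
lemma lintegral_regions_le {α : Type*} [MeasurableSpace α] {μ : Measure α} {δ : α → ℝ}
    (hδ : Measurable δ) {G : Set α} (hG : NullMeasurableSet G μ) {ρ κ c₁ c₂ : ℝ} (hκ : 0 ≤ κ)
    {E₀ E₁ E₂ D : α → ℝ}
    (hfar : ∀ x, ρ ≤ δ x → D x = κ * E₁ x * Real.exp (-(c₁ * δ x ^ 2)))
    (hgood : ∀ x, δ x < ρ → x ∈ G → D x = κ * E₂ x * Real.exp (-(c₂ * δ x ^ 2)))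
    (hbad : ∀ x, δ x < ρ → x ∉ G → D x = (κ + 2) * (1 + E₀ x)) :
    ∫⁻ x, ENNReal.ofReal (D x) ∂μ
      ≤ ENNReal.ofReal κ * (eLpNorm E₁ ⊤ (μ.restrict {x | ρ ≤ δ x})
            * ∫⁻ x in {x | ρ ≤ δ x}, ENNReal.ofReal (Real.exp (-(c₁ * δ x ^ 2))) ∂μ)
        + ENNReal.ofReal κ * (eLpNorm E₂ ⊤ (μ.restrict G)
            * ∫⁻ x in {x | δ x < ρ}, ENNReal.ofReal (Real.exp (-(c₂ * δ x ^ 2))) ∂μ)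
        + ENNReal.ofReal (κ + 2) * ∫⁻ x in {x | δ x < ρ} \ G, ENNReal.ofReal (1 + E₀ x) ∂μ := by
  -- `G` is only null-measurable, so the integral is split along a measurable subset that agrees
  -- with it up to a null set.
  obtain ⟨G', hG'G, hG'm, hG'⟩ := hG.exists_measurable_subset_ae_eq
  have hmf : MeasurableSet {x | ρ ≤ δ x} := measurableSet_le measurable_const hδ
  have hmn : MeasurableSet {x | δ x < ρ} := measurableSet_lt hδ measurable_const
  have hcompl : {x | ρ ≤ δ x}ᶜ = {x | δ x < ρ} := by
    ext x
    simp
  rw [← lintegral_add_compl _ hmf, hcompl, ← lintegral_inter_add_sdiff _ {x | δ x < ρ} hG'm,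
    add_assoc]
  refine add_le_add ?_ (add_le_add ?_ ?_)
  · rw [setLIntegral_congr_fun hmf fun x hx => by rw [hfar x hx]]
    exact lintegral_mul_le_eLpNorm_top_mul hκ _ (by fun_prop) fun x => (Real.exp_pos _).le
  · rw [setLIntegral_congr_fun (hmn.inter hG'm) fun x hx => by rw [hgood x hx.1 (hG'G hx.2)]]
    refine (lintegral_mul_le_eLpNorm_top_mul hκ _ (by fun_prop)
      fun x => (Real.exp_pos _).le).trans ?_
    gcongr
    · exact inter_subset_right.trans hG'G
    · exact inter_subset_left
  · rw [setLIntegral_congr ((ae_eq_refl _).diff hG'),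
      ← lintegral_const_mul' _ _ ENNReal.ofReal_ne_top]
    refine lintegral_mono_ae ?_
    filter_upwards [ae_restrict_mem₀ (hmn.nullMeasurableSet.diff hG)] with x hx
    rw [hbad x hx.1 hx.2, ENNReal.ofReal_mul (by linarith)]

/-- Bookkeeping of the constants. -/
lemma sum_errors_le {κ A₁ A₂ A₃ A₄ L J J' J'' E e₁ e₂ Z : ℝ≥0∞} (hL : L ≠ 0) (hL' : L ≠ ⊤)
    (hJ : J ≤ J') {κ' : ℝ≥0∞} (hκ : κ ≤ κ') :
    κ * (e₁ * (A₁ * (L * (J'' + E)))) + κ * (e₂ * (A₂ * (L * (J + 1)))) + κ' * Z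
        + (A₃ + A₄) * (L * (J + E))
      ≤ (κ' * (A₁ + A₂ + 1) + A₃ + A₄) * (L * (J + E + e₂ * (J' + 1) + e₁ * (J'' + E) + L⁻¹ * Z)) := by
  set B := κ' * (A₁ + A₂ + 1) + A₃ + A₄
  -- Each of the four coefficients is a partial sum of the expanded `B`.
  have hB1 : κ * A₁ ≤ B := by
    calc κ * A₁ ≤ κ' * A₁ := by gcongr
      _ ≤ κ' * A₁ + (κ' * (A₂ + 1) + A₃ + A₄) := le_self_add
      _ = B := by ring
  have hB2 : κ * A₂ ≤ B := by
    calc κ * A₂ ≤ κ' * A₂ := by gcongr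
      _ ≤ κ' * A₂ + (κ' * (A₁ + 1) + A₃ + A₄) := le_self_add
      _ = B := by ring
  have hB3 : κ' ≤ B := by
    calc κ' ≤ κ' + (κ' * (A₁ + A₂) + A₃ + A₄) := le_self_add
      _ = B := by ring
  have hB4 : A₃ + A₄ ≤ B := by
    calc A₃ + A₄ ≤ A₃ + A₄ + κ' * (A₁ + A₂ + 1) := le_self_add
      _ = B := by ring
  have hZ : L * (L⁻¹ * Z) = Z := by
    rw [← mul_assoc, ENNReal.mul_inv_cancel hL hL', one_mul]
  calc _ = κ * A₁ * (L * (e₁ * (J'' + E))) + κ * A₂ * (L * (e₂ * (J + 1))) + κ' * (L * (L⁻¹ * Z))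
        + (A₃ + A₄) * (L * (J + E)) := by rw [hZ]; ring
    _ ≤ B * (L * (e₁ * (J'' + E))) + B * (L * (e₂ * (J' + 1))) + B * (L * (L⁻¹ * Z))
        + B * (L * (J + E)) := by gcongr
    _ = _ := by ring

end NeumannHeat

/-! ### The heat trace estimate -/

open NeumannHeat in
theorem proposition2p1 (d : ℕ) (hd : 2 ≤ d) (η c₁ c₂ : ℝ) (hη : 0 < η) (hc₁ : 0 < c₁)
    (hc₂ : 0 < c₂) :
    ∃ C : ℝ, 0 < C ∧
      ∀ (Ω : Set (NeumannHeat.Euc d)), IsOpen Ω → volume Ω ≠ ⊤ →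
        NeumannHeat.perim Ω ≠ 0 → NeumannHeat.perim Ω ≠ ⊤ →
      ∀ (E₀ E₁ : ℝ → NeumannHeat.Euc d → ℝ) (E₂ : ℝ → ℝ → NeumannHeat.Euc d → ℝ)
        (G : ℝ → Set (NeumannHeat.Euc d)),
        -- the universal upper bound
        (∀ t : ℝ, 0 < t → ∀ x ∈ Ω,
          NeumannHeat.heatKernel Ω t x x ≤ ((t ^ (-(d : ℝ) / 2) * E₀ t x : ℝ) : EReal)) →
        -- the bulk approximation
        (∀ t : ℝ, 0 < t → ∀ x ∈ Ω, η * √t ≤ NeumannHeat.bdryDist Ω x →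
          |(NeumannHeat.heatKernel Ω t x x).toReal - (4 * Real.pi * t) ^ (-(d : ℝ) / 2)|
            ≤ t ^ (-(d : ℝ) / 2) * E₁ t x
              * Real.exp (-(c₁ * NeumannHeat.bdryDist Ω x ^ 2 / t))) →
        -- the half-space approximation on the sets `G r`
        (∀ r : ℝ, 0 < r → NullMeasurableSet (G r) volume ∧ G r ⊆ Ω) →
        (∀ r : ℝ, 0 < r → ∀ t : ℝ, 0 < t → t ≤ r ^ 2 → ∀ x ∈ G r,
          |(NeumannHeat.heatKernel Ω t x x).toReal
              - (4 * Real.pi * t) ^ (-(d : ℝ) / 2)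
                * (1 + Real.exp (-(NeumannHeat.bdryDist Ω x ^ 2 / t)))|
            ≤ t ^ (-(d : ℝ) / 2) * E₂ r t x
              * Real.exp (-(c₂ * NeumannHeat.bdryDist Ω x ^ 2 / t))) →
      ∀ c : ℝ, c = min (1 / 8) (min (c₂ / 8) (c₁ / 2)) →
      ∀ r t : ℝ, 0 < t → max 1 η * √t ≤ r →
        (((ENNReal.ofReal ((4 * Real.pi * t) ^ ((d : ℝ) / 2)) * NeumannHeat.heatTrace Ω t
              : ℝ≥0∞) : EReal)
            - (volume Ω : EReal)
            - ((√(Real.pi * t) / 2 : ℝ) : EReal) * (NeumannHeat.perim Ω : EReal)).abs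
          ≤ ENNReal.ofReal C * (ENNReal.ofReal √t * NeumannHeat.perim Ω *
            ( NeumannHeat.varthetaIntegral Ω c t (Ioo 0 (r / √t))
              + ENNReal.ofReal (Real.exp (-(c * r ^ 2 / t)))
              + eLpNorm (E₂ r t) ⊤ (volume.restrict (G r))
                  * (NeumannHeat.varthetaIntegral Ω c t (Ioo 0 (2 * r / √t)) + 1)
              + eLpNorm (E₁ t) ⊤ (volume.restrict {x ∈ Ω | r ≤ NeumannHeat.bdryDist Ω x})
                  * (NeumannHeat.varthetaIntegral Ω c t (Ioi (r / √t))
                    + ENNReal.ofReal (Real.exp (-(c * r ^ 2 / t))))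
              + (ENNReal.ofReal √t * NeumannHeat.perim Ω)⁻¹
                  * ∫⁻ x in {x ∈ Ω | NeumannHeat.bdryDist Ω x < r} \ G r,
                      ENNReal.ofReal (1 + E₀ t x))) := by
  have hpi := Real.pi_pos
  obtain ⟨c, hcdef⟩ : ∃ c, c = min (1 / 8) (min (c₂ / 8) (c₁ / 2)) := ⟨_, rfl⟩
  have hc : 0 < c := by rw [hcdef]; positivity
  have hc8 : c ≤ 1 / 8 := by rw [hcdef]; exact min_le_left _ _
  have hcc₂ : c ≤ c₂ / 8 := by rw [hcdef]; exact (min_le_right _ _).trans (min_le_left _ _)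
  have hcc₁ : c ≤ c₁ / 2 := by rw [hcdef]; exact (min_le_right _ _).trans (min_le_right _ _)
  refine ⟨(traceConst d c₁ c₂ c).toReal + 1, by positivity, ?_⟩
  intro Ω hΩ hfin hP0 hP E₀ E₁ E₂ G h₀ h₁ hG h₂ c' hc' r t ht hr
  obtain rfl : c' = c := hc'.trans hcdef.symm
  have hC : traceConst d c₁ c₂ c' ≤ ENNReal.ofReal ((traceConst d c₁ c₂ c').toReal + 1) := by
    rw [← ENNReal.ofReal_toReal (traceConst_ne_top (d := d) (c₁ := c₁) (c₂ := c₂) hc),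
      ENNReal.toReal_ofReal ENNReal.toReal_nonneg]
    exact ENNReal.ofReal_le_ofReal (by linarith)
  refine le_trans ?_ (mul_le_mul_left hC _)
  have hst : 0 < √t := Real.sqrt_pos.mpr ht
  have hsq : √t ^ 2 = t := Real.sq_sqrt ht.le
  -- The whole space has empty frontier, contradicting the nonzero perimeter.
  have hne : Ωᶜ.Nonempty := by
    rw [nonempty_compl]
    rintro rfl
    exact hP0 (by simp [perim])
  have hr1 : √t ≤ r := le_trans (by nlinarith [le_max_left 1 η]) hr
  have hrη : η * √t ≤ r := le_trans (by gcongr; exact le_max_right 1 η) hr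
  have hr0 : 0 < r := hst.trans_le hr1
  set μ := volume.restrict Ω with hμ
  -- Lengths are measured in units of `√t` from here on.
  set δ : Euc d → ℝ := fun x => bdryDist Ω x / √t with hδdef
  set ρ := r / √t with hρdef
  have hρ : 1 ≤ ρ := (one_le_div hst).mpr hr1
  have hδ : Measurable δ := (measurable_bdryDist Ω).div_const _
  have hδ0 : ∀ x, 0 ≤ δ x := fun x => div_nonneg Metric.infDist_nonneg hst.le
  have hδsq : ∀ x, δ x ^ 2 = bdryDist Ω x ^ 2 / t := fun x => by rw [hδdef, div_pow, hsq]
  have hρsq : ρ ^ 2 = r ^ 2 / t := by rw [hρdef, div_pow, hsq]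
  have hδρ : ∀ x, δ x < ρ ↔ bdryDist Ω x < r := fun x => div_lt_div_iff_of_pos_right hst
  have hδρ' : ∀ x, ρ ≤ δ x ↔ r ≤ bdryDist Ω x := fun x => div_le_div_iff_of_pos_right hst
  set κ := (4 * Real.pi) ^ ((d : ℝ) / 2) with hκdef
  set N := (4 * Real.pi * t) ^ ((d : ℝ) / 2) with hNdef
  have hκ : 0 < κ := by positivity
  have hN : 0 < N := by positivity
  obtain ⟨hNT, hNF⟩ := norm_factor_mul (d := d) ht
  rw [← hNdef, ← hκdef] at hNT
  rw [← hNdef] at hNF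
  -- The model for `N k(t,x,x)`: the half-space profile up to distance `r` from `Ω^c`, the constant
  -- `1` beyond.
  set w : Euc d → ℝ := fun x => 1 + {x | δ x < ρ}.indicator (fun x => Real.exp (-(δ x ^ 2))) x
    with hwdef
  have hmn : MeasurableSet {x | δ x < ρ} := measurableSet_lt hδ measurable_const
  have hw : Measurable w :=
    measurable_const.add (Measurable.indicator (by fun_prop) hmn)
  classical
  -- On the bad set `0 ≤ N k ≤ κ E₀` and `0 ≤ w ≤ 2`, whence `(κ + 2)(1 + E₀)`; there `E₀ ≥ 0`
  -- follows from `k ≥ 0`.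
  set D : Euc d → ℝ := fun x => if ρ ≤ δ x then κ * E₁ t x * Real.exp (-(c₁ * δ x ^ 2))
    else if x ∈ G r then κ * E₂ r t x * Real.exp (-(c₂ * δ x ^ 2)) else (κ + 2) * (1 + E₀ t x)
    with hDdef
  have hk0 : ∀ x, 0 ≤ (heatKernel Ω t x x).toReal := fun x =>
    EReal.toReal_nonneg (heatKernel_self_nonneg Ω t x)
  have htop : ∀ x ∈ Ω, heatKernel Ω t x x ≠ ⊤ := fun x hx =>
    ((h₀ t ht x hx).trans_lt (EReal.coe_lt_top _)).ne
  have hD : ∀ x ∈ Ω, |N * (heatKernel Ω t x x).toReal - w x| ≤ D x := by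
    intro x hx
    by_cases hfar : ρ ≤ δ x
    · have hw1 : w x = 1 := by simp [hwdef, not_lt.mpr hfar]
      have hx1 := h₁ t ht x hx (hrη.trans ((hδρ' x).mp hfar))
      rw [mul_div_assoc, ← hδsq, mul_assoc (t ^ _)] at hx1
      rw [hDdef, hw1]
      simp only [hfar, if_true]
      rw [mul_assoc]
      exact abs_mul_sub_le_of_abs_sub_le hN.le hNT hNF (by rwa [mul_one])
    · have hnear : δ x < ρ := not_le.mp hfar
      have hw1 : w x = 1 + Real.exp (-(δ x ^ 2)) := by simp [hwdef, hnear]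
      by_cases hxG : x ∈ G r
      · have ht2 : t ≤ r ^ 2 := by
          rw [← hsq]
          exact pow_le_pow_left₀ hst.le hr1 2
        have hx2 := h₂ r hr0 t ht ht2 x hxG
        rw [mul_div_assoc, ← hδsq, mul_assoc (t ^ _)] at hx2
        rw [hDdef, hw1]
        simp only [hfar, hxG, if_true, if_false]
        rw [mul_assoc]
        exact abs_mul_sub_le_of_abs_sub_le hN.le hNT hNF hx2
      · have hx0 : (heatKernel Ω t x x).toReal ≤ t ^ (-(d : ℝ) / 2) * E₀ t x := by
          have h := EReal.toReal_le_toReal (h₀ t ht x hx)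
            (ne_of_gt (lt_of_lt_of_le (by simp) (heatKernel_self_nonneg Ω t x)))
            (EReal.coe_ne_top _)
          rwa [EReal.toReal_coe] at h
        have hu : N * (heatKernel Ω t x x).toReal ≤ κ * E₀ t x := by
          rw [← hNT, mul_assoc]
          gcongr
        have hl : 0 ≤ N * (heatKernel Ω t x x).toReal := mul_nonneg hN.le (hk0 x)
        have hE0 : 0 ≤ E₀ t x := nonneg_of_mul_nonneg_right (hl.trans hu) hκ
        have he1 : Real.exp (-(δ x ^ 2)) ≤ 1 := by
          rw [Real.exp_le_one_iff]
          linarith [sq_nonneg (δ x)]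
        have he0 := Real.exp_pos (-(δ x ^ 2))
        rw [hDdef, hw1]
        simp only [hfar, hxG, if_false]
        rw [abs_le]
        constructor <;> nlinarith [mul_nonneg hκ.le hE0]
  obtain ⟨hup, hlo⟩ := heatTrace_comparison hΩ hfin hN hw htop hD
  have hwint : ∫⁻ x in Ω, ENNReal.ofReal (w x) = volume Ω
      + ∫⁻ x in {x | δ x < ρ}, ENNReal.ofReal (Real.exp (-(δ x ^ 2))) ∂μ := by
    have e : ∀ x, ENNReal.ofReal (w x)
        = 1 + {x | δ x < ρ}.indicator (fun x => ENNReal.ofReal (Real.exp (-(δ x ^ 2)))) x := by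
      intro x
      by_cases hx : δ x < ρ
      · simp [hwdef, hx, ENNReal.ofReal_add, (Real.exp_pos _).le]
      · simp [hwdef, hx]
    simp_rw [e]
    rw [lintegral_add_left measurable_const, lintegral_indicator hmn]
    simp [hμ]
  set M := ∫⁻ x in {x | δ x < ρ}, ENNReal.ofReal (Real.exp (-(δ x ^ 2))) ∂μ
  set L := ENNReal.ofReal √t * perim Ω with hLdef
  have hL0 : L ≠ 0 := mul_ne_zero (by simpa using ht) hP0
  have hLt : L ≠ ⊤ := ENNReal.mul_ne_top ENNReal.ofReal_ne_top hP
  set q : ℝ → ℝ := fun u => vartheta Ω (u * √t)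
  have hV : ∀ u, 0 < u → μ {x | δ x < u} ≤ L * ENNReal.ofReal (u * (1 + |q u|)) :=
    fun u hu => collar_le hfin hP0 hP ht hu
  have hV' : ∀ u, 0 < u →
      L * ENNReal.ofReal u ≤ μ {x | δ x < u} + L * ENNReal.ofReal (u * |q u|) :=
    fun u hu => le_collar_add hfin hP0 hP ht hu
  have hdouble : μ {x | δ x < ρ} ≤ 2 ^ d * μ {x | δ x < ρ / 2} := collar_doubling hΩ hne ht ρ
  have hK : (2 : ℝ≥0∞) ^ d ≠ ⊤ := by finiteness
  have hMup := lintegral_gaussian_sublevel_le_add hδ hδ0 hLt hV hK hc (by linarith) hρ hdouble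
  have hMlo := le_lintegral_gaussian_sublevel_add (μ := μ) hδ hδ0 hLt hV' hc (by linarith)
    (by linarith : 0 < ρ)
  have hfarI := lintegral_gaussian_superlevel_le_gaussIntegral (a := c₁) hδ hδ0 hLt hV hc
    (by linarith) (by linarith : 0 < ρ)
  have hnearI := lintegral_gaussian_sublevel_le_gaussIntegral (a := c₂) hδ hδ0 hLt hV hK hc
    (by linarith) hρ hdouble
  -- The second moment is `√π/4`, so `2L` times it is exactly the perimeter term.
  have hm : ((√(Real.pi * t) / 2 : ℝ) : EReal) * (perim Ω : EReal)
      = ((2 * L * gaussMoment 1 : ℝ≥0∞) : EReal) := by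
    have : 2 * L * gaussMoment 1 = ENNReal.ofReal (√(Real.pi * t) / 2) * perim Ω := by
      calc _ = ENNReal.ofReal 2 * ENNReal.ofReal √t * ENNReal.ofReal (√Real.pi / 4) * perim Ω := by
            rw [hLdef, gaussMoment_one, ENNReal.ofReal_ofNat]
            ring
        _ = _ := by
            rw [← ENNReal.ofReal_mul (by norm_num), ← ENNReal.ofReal_mul (by positivity),
              Real.sqrt_mul hpi.le]
            ring_nf
    rw [this, EReal.coe_ennreal_mul, EReal.coe_ennreal_ofReal, max_eq_left (by positivity)]
  have hset1 : μ.restrict {x | ρ ≤ δ x} = volume.restrict {x ∈ Ω | r ≤ bdryDist Ω x} := by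
    rw [hμ, Measure.restrict_restrict (measurableSet_le measurable_const hδ)]
    congr 1
    ext x
    simp only [mem_inter_iff, mem_ofPred_eq, hδρ']
    tauto
  have hset2 : μ.restrict (G r) = volume.restrict (G r) := by
    rw [hμ, Measure.restrict_restrict_of_subset (hG r hr0).2]
  have hset3 : μ.restrict ({x | δ x < ρ} \ G r)
      = volume.restrict ({x ∈ Ω | bdryDist Ω x < r} \ G r) := by
    rw [hμ, Measure.restrict_restrict₀ ((hmn.nullMeasurableSet.diff
      (hG r hr0).1).mono_ac Measure.restrict_le_self.absolutelyContinuous)]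
    congr 1
    ext x
    simp only [mem_inter_iff, mem_ofPred_eq, Set.mem_sdiff, hδρ]
    tauto
  have hDint := lintegral_regions_le (μ := μ) (D := D) (ρ := ρ) (κ := κ) (c₁ := c₁) (c₂ := c₂)
    (E₀ := E₀ t) (E₁ := E₁ t) (E₂ := E₂ r t) (G := G r) hδ
    ((hG r hr0).1.mono_ac Measure.restrict_le_self.absolutelyContinuous) hκ.le
    (fun x hx => by simp [hDdef, hx]) (fun x hx hxG => by simp [hDdef, not_le.mpr hx, hxG])
    (fun x hx hxG => by simp [hDdef, not_le.mpr hx, hxG])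
  rw [hset2, hset3] at hDint
  set R := ∫⁻ x in Ω, ENNReal.ofReal (D x) with hR
  rw [mul_div_assoc c' (r ^ 2) t, ← hρsq]
  set E := ENNReal.ofReal (Real.exp (-(c' * ρ ^ 2)))
  -- The argument yields the integral up to `ρ`; it is enlarged to the stated range `2ρ`.
  have hJ : gaussIntegral q c' (Ioo 0 ρ) ≤ varthetaIntegral Ω c' t (Ioo 0 (2 * r / √t)) := by
    refine lintegral_mono_set (Ioo_subset_Ioo_right ?_)
    rw [mul_div_assoc]
    linarith
  rw [hm]
  rw [hwint] at hup hlo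
  have hfinal := sum_errors_le (A₁ := ENNReal.ofReal (2 * c₁) * (gaussMoment c' + 1))
    (A₂ := ENNReal.ofReal (2 * c₂) * (gaussMoment c' + 1)
      + 2 * 2 ^ d * ENNReal.ofReal (1 / c' + 2))
    (A₃ := 2 + 2 * 2 ^ d * ENNReal.ofReal (1 / c' + 2)) (A₄ := 2 * (gaussMoment c' + 1))
    (J'' := gaussIntegral q c' (Ioi ρ)) (E := E)
    (e₁ := eLpNorm (E₁ t) ⊤ (volume.restrict {x ∈ Ω | r ≤ bdryDist Ω x}))
    (e₂ := eLpNorm (E₂ r t) ⊤ (volume.restrict (G r)))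
    (Z := ∫⁻ x in {x ∈ Ω | bdryDist Ω x < r} \ G r, ENNReal.ofReal (1 + E₀ t x))
    hL0 hLt hJ (ENNReal.ofReal_le_ofReal (by linarith : κ ≤ κ + 2))
  rw [← hset1] at hfinal ⊢
  change _ ≤ _ * (L * (gaussIntegral q c' (Ioo 0 ρ) + E + _ + _ * (gaussIntegral q c' (Ioi ρ) + E) + _))
  -- The upper and lower constants for the deviation of `M` from the main term are added, so that
  -- one error serves both inequalities.
  refine le_trans (abs_coe_sub_sub_le hfin (ENNReal.mul_ne_top (ENNReal.mul_ne_top (by norm_num) hLt)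
    (gaussMoment_ne_top one_pos)) (R := R + (2 + 2 * 2 ^ d * ENNReal.ofReal (1 / c' + 2)
      + 2 * (gaussMoment c' + 1)) * (L * (gaussIntegral q c' (Ioo 0 ρ) + E))) ?_ ?_)
    (le_trans (add_le_add (hDint.trans ?_) le_rfl) hfinal)
  · calc _ ≤ volume Ω + M + R := hup
      _ ≤ volume Ω + (2 * L * gaussMoment 1 + (2 + 2 * 2 ^ d * ENNReal.ofReal (1 / c' + 2)) *
          (L * (gaussIntegral q c' (Ioo 0 ρ) + E))) + R := by gcongr
      _ ≤ volume Ω + (2 * L * gaussMoment 1 + (2 + 2 * 2 ^ d * ENNReal.ofReal (1 / c' + 2)) *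
          (L * (gaussIntegral q c' (Ioo 0 ρ) + E))) + R
          + 2 * (gaussMoment c' + 1) * (L * (gaussIntegral q c' (Ioo 0 ρ) + E)) := le_self_add
      _ = _ := by ring
  · calc _ ≤ volume Ω + (M + 2 * (gaussMoment c' + 1) *
          (L * (gaussIntegral q c' (Ioo 0 ρ) + E))) := by gcongr
      _ = volume Ω + M + 2 * (gaussMoment c' + 1) *
          (L * (gaussIntegral q c' (Ioo 0 ρ) + E)) := (add_assoc _ _ _).symm
      _ ≤ ENNReal.ofReal N * heatTrace Ω t + R + 2 * (gaussMoment c' + 1) *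
          (L * (gaussIntegral q c' (Ioo 0 ρ) + E)) := by gcongr
      _ ≤ ENNReal.ofReal N * heatTrace Ω t + R + 2 * (gaussMoment c' + 1) *
          (L * (gaussIntegral q c' (Ioo 0 ρ) + E))
          + (2 + 2 * 2 ^ d * ENNReal.ofReal (1 / c' + 2)) *
          (L * (gaussIntegral q c' (Ioo 0 ρ) + E)) := le_self_add
      _ = _ := by ring
  · gcongr
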